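/- Let $n\ge 3$ and $2\le i\le n-1$. A lattice path with $n$ unit north and east steps is identified with the set $A\subseteq[n]$ of positions of its north steps. For paths $U,L\subseteq[n]$ with $|U|=|L|$ and $U$ weakly above $L$, let $M[U,L]$ be the lattice path matroid on $[n]$ whose bases are the (north-step sets of) lattice paths, with the same endpoints, that lie weakly between $L$ and $U$. Let $\mathcal P_n$ be the set of all lattice path matroids on $[n]$, ordered by $M'\le_q M$ if $M'$ is a matroid quotient of $M$, i.e. if there are a matroid $N$ and a subset $T$ of its ground set with $M=N\setminus T$ and $M'=N/T$. Its least element is the uniform matroid $U_{0,n}$ and its greatest element is $U_{n,n}$. For a cover relation $M[U',L']\lessdot M[U,L]$ in $\mathcal P_n$, one has $L\setminus L'=\{\ell\}$ and $U\setminus U'=\{u\}$, and the cover relation is labeled by the pair $(\ell,u)\in[n]\times[n]$. A maximal chain $U_{0,n}=x_0\lessdot x_1\lessdot\dots\lessdot x_n=U_{n,n}$ with labels $(\ell_j,u_j)$ of $x_{j-1}\lessdot x_j$ is called falling if there is no $1\le j<n$ with both $\ell_j<\ell_{j+1}$ and $u_j<u_{j+1}$; its lower-path permutation is $\sigma\in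 S_n$, $\sigma(j)=\ell_j$. Let $w_0\in S_n$ be the longest permutation, $w_0(j)=n+1-j$, and let $s_i$ be the transposition $(i\;\,i+1)$, so that $s_iw_0$ is obtained from the one-line notation $n\,(n-1)\cdots 1$ by exchanging the values $i$ and $i+1$. Then the number of falling chains of $\mathcal P_n$ with lower-path permutation $s_iw_0$ equals $$\frac{n!}{(n-i)(n-i+1)}+\frac{n!}{i(i+1)}+\frac{n!}{i(n-i)}+\frac{n!}{2}-\frac{n!}{i}-\frac{n!}{n-i}-(i-1)!\,(n-1-i)!.$$ -/

import Mathlib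

/-- A monotone lattice path with `n` unit steps is encoded by the set `A` of its north steps.
`northCount A t` is the height of the path after its first `t` steps. -/
def northCount {n : ℕ} (A : Finset (Fin n)) (t : ℕ) : ℕ :=
  (A.filter (fun a => a.val < t)).card

/-- The path `A` stays weakly below the path `B`. -/
def WeaklyBelow {n : ℕ} (A B : Finset (Fin n)) : Prop :=
  ∀ t : ℕ, northCount A t ≤ northCount B t

theorem northCount_zero {n : ℕ} (A : Finset (Fin n)) : northCount A 0 = 0 := by
  simp [northCount]

theorem northCount_eq_card {n : ℕ} (A : Finset (Fin n)) {t : ℕ} (ht : n ≤ t) :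
    northCount A t = A.card := by
  unfold northCount
  rw [Finset.filter_true_of_mem]
  intro a _
  exact a.2.trans_le ht

theorem northCount_succ {n : ℕ} (A : Finset (Fin n)) (a : Fin n) :
    northCount A (a.val + 1) = northCount A a.val + if a ∈ A then 1 else 0 := by
  unfold northCount
  split_ifs with h
  · have : A.filter (fun b => b.val < a.val + 1)
        = insert a (A.filter (fun b => b.val < a.val)) := by
      ext b
      simp only [Finset.mem_filter, Finset.mem_insert]
      constructor
      · rintro ⟨hb, hlt⟩
        by_cases hba : b = a
        · exact Or.inl hba
        · exact Or.inr ⟨hb, by have := Fin.val_ne_of_ne hba; omega⟩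
      · rintro (rfl | ⟨hb, hlt⟩)
        · exact ⟨h, by omega⟩
        · exact ⟨hb, by omega⟩
    rw [this, Finset.card_insert_of_notMem (by simp)]
  · congr 1
    ext b
    simp only [Finset.mem_filter]
    constructor
    · rintro ⟨hb, hlt⟩
      have hba : b ≠ a := by rintro rfl; exact h hb
      exact ⟨hb, by have := Fin.val_ne_of_ne hba; omega⟩
    · rintro ⟨hb, hlt⟩
      exact ⟨hb, by omega⟩

theorem northCount_exchange {n : ℕ} (A : Finset (Fin n)) {x y : Fin n} (hx : x ∈ A)
    (hy : y ∉ A) (t : ℕ) :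
    northCount (insert y (A.erase x)) t + (if x.val < t then 1 else 0)
      = northCount A t + (if y.val < t then 1 else 0) := by
  induction t with
  | zero => simp [northCount_zero]
  | succ t ih =>
    have hxy : x ≠ y := by rintro rfl; exact hy hx
    by_cases ht : t < n
    · have h1 := northCount_succ (insert y (A.erase x)) ⟨t, ht⟩
      have h2 := northCount_succ A ⟨t, ht⟩
      simp only at h1 h2
      rw [h1, h2]
      by_cases hxt : x = ⟨t, ht⟩
      · subst hxt
        have : y.val ≠ t := fun h => hxy (Fin.ext h.symm)
        simp only [Finset.mem_insert, Finset.mem_erase, hxy, hx] at *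
        simp at *
        split_ifs at * <;> omega
      · have hxt' : x.val ≠ t := fun h => hxt (Fin.ext h)
        by_cases hyt : y = ⟨t, ht⟩
        · subst hyt
          simp only [Finset.mem_insert, hy] at *
          simp at *
          split_ifs at * <;> omega
        · have hyt' : y.val ≠ t := fun h => hyt (Fin.ext h)
          have : (⟨t, ht⟩ : Fin n) ∈ insert y (A.erase x) ↔ (⟨t, ht⟩ : Fin n) ∈ A := by
            simp [Finset.mem_insert, Finset.mem_erase, Ne.symm hyt, Ne.symm hxt]
          simp only [this]
          split_ifs at * <;> omega
    · rw [northCount_eq_card _ (by omega : n ≤ t)] at ih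
      rw [northCount_eq_card _ (by omega : n ≤ t)] at ih
      rw [northCount_eq_card _ (by omega : n ≤ t + 1), northCount_eq_card _ (by omega : n ≤ t + 1)]
      have := x.2
      have := y.2
      split_ifs at * <;> omega

/-- The diagram of a lattice path matroid on the ground set `Fin n` (standing for `[n]`): an upper
path `U` and a lower path `L` with the same endpoints such that `U` stays weakly above `L`. -/
@[ext]
structure LPM (n : ℕ) where
  U : Finset (Fin n)
  L : Finset (Fin n)
  card_eq : L.card = U.card
  noncrossing : WeaklyBelow L U

namespace LPM

/-- The sets of north steps of the lattice paths between the lower and the upper path. (Taking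
`t = n` shows that such a path has the same endpoints as `U` and `L`.) -/
def IsBase {n : ℕ} (x : LPM n) (S : Set (Fin n)) : Prop :=
  ∃ B : Finset (Fin n), (B : Set (Fin n)) = S ∧ WeaklyBelow x.L B ∧ WeaklyBelow B x.U

theorem isBase_exchange {n : ℕ} (x : LPM n) : Matroid.ExchangeProperty x.IsBase := by
  rintro _ _ ⟨A, rfl, hLA, hAU⟩ ⟨B, rfl, hLB, hBU⟩ a ha
  have haA : a ∈ A := by simpa using ha.1
  have haB : a ∉ B := by simpa using ha.2
  have hAn : northCount A n = northCount B n := by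
    have h1 := hLA n
    have h2 := hAU n
    have h3 := hLB n
    have h4 := hBU n
    have h5 := x.card_eq
    rw [northCount_eq_card _ le_rfl] at h1 h2 h3 h4
    rw [northCount_eq_card _ le_rfl] at h1 h2 h3 h4
    rw [northCount_eq_card _ le_rfl, northCount_eq_card _ le_rfl]
    omega
  have hsA := northCount_succ A a
  have hsB := northCount_succ B a
  simp only [haA, haB, if_true, if_false] at hsA hsB
  have key : ∃ b : Fin n, b ∈ B ∧ b ∉ A ∧
      WeaklyBelow x.L (insert b (A.erase a)) ∧ WeaklyBelow (insert b (A.erase a)) x.U := by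
    by_cases hd : northCount B (a.val + 1) < northCount A (a.val + 1)
    · -- the first time after `a` at which the two paths meet again
      have hex : ∃ t, a.val + 1 ≤ t ∧ northCount A t ≤ northCount B t := ⟨n, a.2, hAn.le⟩
      classical
      obtain ⟨ht1, ht2⟩ := Nat.find_spec hex
      have hmin := fun m (hm : m < Nat.find hex) => Nat.find_min hex hm
      have htn : Nat.find hex ≤ n := Nat.find_min' hex ⟨a.2, hAn.le⟩
      generalize Nat.find hex = t at ht1 ht2 hmin htn
      obtain ⟨s, rfl⟩ : ∃ s, t = s + 1 := ⟨t - 1, by omega⟩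
      have hsne : s ≠ a.val := by rintro rfl; omega
      have hs := hmin s (by omega)
      have h1 := northCount_succ A ⟨s, by omega⟩
      have h2 := northCount_succ B ⟨s, by omega⟩
      simp only at h1 h2
      have hbA : (⟨s, by omega⟩ : Fin n) ∉ A := by
        intro h
        rw [if_pos h] at h1
        split_ifs at h2 <;> omega
      have hbB : (⟨s, by omega⟩ : Fin n) ∈ B := by
        by_contra h
        rw [if_neg h] at h2
        split_ifs at h1 <;> omega
      refine ⟨⟨s, by omega⟩, hbB, hbA, fun t => ?_, fun t => ?_⟩
      · have he := northCount_exchange A haA hbA t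
        have := hLA t
        have := hLB t
        have hm := hmin t
        simp only at he
        split_ifs at he <;> omega
      · have he := northCount_exchange A haA hbA t
        have := hAU t
        simp only at he
        split_ifs at he <;> omega
    · -- the last time before `a` at which the two paths meet
      have hex : ∃ k, k ≤ a.val ∧ northCount B (a.val - k) ≤ northCount A (a.val - k) :=
        ⟨a.val, le_rfl, by simp [northCount_zero]⟩
      classical
      obtain ⟨hk1, hk2⟩ := Nat.find_spec hex
      have hmin := fun m (hm : m < Nat.find hex) => Nat.find_min hex hm
      generalize Nat.find hex = k at hk1 hk2 hmin
      have hk0 : k ≠ 0 := by rintro rfl; simp at hk2; omega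
      obtain ⟨s, hs⟩ : ∃ s, s = a.val - k := ⟨_, rfl⟩
      have han := a.2
      have hnext : northCount A (s + 1) < northCount B (s + 1) := by
        have := hmin (k - 1) (by omega)
        have e : a.val - (k - 1) = s + 1 := by omega
        rw [e] at this
        omega
      rw [← hs] at hk2
      have h1 := northCount_succ A ⟨s, by omega⟩
      have h2 := northCount_succ B ⟨s, by omega⟩
      simp only at h1 h2
      have hbA : (⟨s, by omega⟩ : Fin n) ∉ A := by
        intro h
        rw [if_pos h] at h1
        split_ifs at h2 <;> omega
      have hbB : (⟨s, by omega⟩ : Fin n) ∈ B := by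
        by_contra h
        rw [if_neg h] at h2
        split_ifs at h1 <;> omega
      refine ⟨⟨s, by omega⟩, hbB, hbA, fun t => ?_, fun t => ?_⟩
      · have he := northCount_exchange A haA hbA t
        have := hLA t
        simp only at he
        split_ifs at he <;> omega
      · have he := northCount_exchange A haA hbA t
        have := hAU t
        have := hBU t
        simp only at he
        by_cases hta : t ≤ a.val
        · have hm := hmin (a.val - t)
          have e : a.val - (a.val - t) = t := by omega
          rw [e] at hm
          split_ifs at he <;> omega
        · split_ifs at he <;> omega
  obtain ⟨b, hbB, hbA, h1, h2⟩ := key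
  refine ⟨b, by simp [hbB, hbA], insert b (A.erase a), ?_, h1, h2⟩
  simp

/-- The lattice path matroid `M[U, L]` on the ground set `Fin n`. -/
def toMatroid {n : ℕ} (x : LPM n) : Matroid (Fin n) :=
  Matroid.ofIsBaseOfFinite (E := Set.univ) Set.finite_univ x.IsBase
    ⟨x.L, x.L, rfl, fun _ => le_rfl, x.noncrossing⟩ x.isBase_exchange
    (fun _ _ => Set.subset_univ _)

/-- `x ≤ y` means that `x` is a matroid quotient of `y`: for some matroid `N` on the disjoint union
of the ground set and a finite set `T`, deleting `T` gives `y` and contracting `T` gives `x`. -/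
instance {n : ℕ} : LE (LPM n) where
  le x y := ∃ (m : ℕ) (N : Matroid (Fin n ⊕ Fin m)), N.E = Set.univ ∧
    y.toMatroid.mapEmbedding Function.Embedding.inl = N.delete (Set.range Sum.inr) ∧
    x.toMatroid.mapEmbedding Function.Embedding.inl = N.contract (Set.range Sum.inr)

/-- The strict order; the cover relation `x ⋖ y` of the quotient order refers to it. -/
instance {n : ℕ} : LT (LPM n) where
  lt x y := x ≤ y ∧ x ≠ y

/-- The uniform matroid of rank `0`, the least element of the quotient order. -/
def bottom (n : ℕ) : LPM n := ⟨∅, ∅, rfl, fun _ => le_rfl⟩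

/-- The uniform matroid of rank `n`, the greatest element of the quotient order. -/
def top (n : ℕ) : LPM n := ⟨Finset.univ, Finset.univ, rfl, fun _ => le_rfl⟩

/-- The pair `p = (ℓ, u)` is the label of the cover relation `x ⋖ y`: the lower path of `y` has the
additional north step `ℓ`, and its upper path has the additional north step `u`. -/
def IsLabel {n : ℕ} (x y : LPM n) (p : Fin n × Fin n) : Prop :=
  y.L \ x.L = {p.1} ∧ y.U \ x.U = {p.2}

/-- Maximal chains `0̂ = c 0 ⋖ c 1 ⋖ ⋯ ⋖ c n = 1̂` of the quotient order. -/
def IsMaximalChain {n : ℕ} (c : Fin (n + 1) → LPM n) : Prop :=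
  c 0 = bottom n ∧ c (Fin.last n) = top n ∧ ∀ j : Fin n, c j.castSucc ⋖ c j.succ

/-- The edges of the chain `c`, from bottom to top, carry the labels `(σ j, τ j)`. -/
def HasLabels {n : ℕ} (c : Fin (n + 1) → LPM n) (σ τ : Equiv.Perm (Fin n)) : Prop :=
  ∀ j : Fin n, IsLabel (c j.castSucc) (c j.succ) (σ j, τ j)

/-- The falling condition for the label sequence `(σ j, τ j)`: no label is strictly smaller than the
next one in the componentwise order on pairs. -/
def IsFalling {n : ℕ} (σ τ : Equiv.Perm (Fin n)) : Prop :=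
  ∀ j k : Fin n, j.val + 1 = k.val → ¬ ((σ j, τ j) : Fin n × Fin n) < (σ k, τ k)

/-- The set `C_σ` of falling chains whose lower-path permutation is `σ`. -/
def fallingChains {n : ℕ} (σ : Equiv.Perm (Fin n)) : Set (Fin (n + 1) → LPM n) :=
  {c | IsMaximalChain c ∧ ∃ τ : Equiv.Perm (Fin n), HasLabels c σ τ ∧ IsFalling σ τ}

end LPM

/-- The simple transposition `s_i` exchanging the `i`-th and the `(i+1)`-st element, `1 ≤ i < n`
(the element `k` of `[n]` is `k - 1` in `Fin n`). -/
def simpleTransposition (n i : ℕ) (hi : 1 ≤ i) (hin : i < n) : Equiv.Perm (Fin n) :=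
  Equiv.swap ⟨i - 1, by omega⟩ ⟨i, hin⟩

/-- The longest permutation `w₀`, i.e. `n, n - 1, …, 1` in one-line notation. -/
def longestPerm (n : ℕ) : Equiv.Perm (Fin n) := Fin.revPerm

/-! Positions are counted from `0`, and `m = n - i`. A maximal chain with labels `(σ, τ)` is
determined by them: its rank `j` member has as lower and upper path the sets of the first `j` values
of `σ` and `τ` (`eq_prefixSet`). So the falling chains with `σ = s_i w₀` correspond to certain
permutations `τ`.

For `σ = s_i w₀` the lower path of rank `j` is the lowest path of height `j`, except at `j = m`,
where it is the second lowest. Hence the bases in rank `j ≠ m` are all paths of height `j` below the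
upper path, and in rank `m` just the lowest one is missing. The condition on `τ` therefore concerns
only the two steps next to rank `m`. Away from them every step is a quotient (`le_of_erase`). The
step into rank `m` is a quotient iff some value after position `m - 1` exceeds `τ (m - 1)`; the step
out of rank `m` is one iff some value before position `m` is smaller than `τ m`. Sufficiency comes
from an explicit one-element extension, from which one base is removed (`Exchange.erase_base`);
necessity comes from extending bases upwards and shrinking them downwards along a quotient. As `σ`
ascends only between positions `m - 1` and `m`, falling means `τ m < τ (m - 1)`. These three
conditions form `IsAdmissible`.

They are counted by inclusion-exclusion (`ncard_isAdmissible`). Among the `n!/2` permutations with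
the required descent, the bad ones have `τ (m - 1)` maximal from there on, or `τ m` minimal up to
there. Each kind is counted by symmetry. For their intersection, exchanging the two entries gives a
minimum and a maximum over disjoint blocks, apart from a rigid family of `(m - 1)! (n - 1 - m)!`
permutations. -/

section NorthCount

variable {n : ℕ}

/-! ### Heights of paths and the lowest path. -/

theorem northCount_insert {A : Finset (Fin n)} {a : Fin n} (ha : a ∉ A) (t : ℕ) :
    northCount (insert a A) t = northCount A t + if a.val < t then 1 else 0 := by
  unfold northCount
  rw [Finset.filter_insert]
  split_ifs with h
  · rw [Finset.card_insert_of_notMem (by simp [ha])]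
  · rfl

theorem northCount_erase {A : Finset (Fin n)} {a : Fin n} (ha : a ∈ A) (t : ℕ) :
    northCount (A.erase a) t + (if a.val < t then 1 else 0) = northCount A t := by
  have h := northCount_insert (A := A.erase a) (a := a) (by simp) t
  rw [Finset.insert_erase ha] at h
  exact h.symm

theorem northCount_mono {A B : Finset (Fin n)} (h : A ⊆ B) (t : ℕ) :
    northCount A t ≤ northCount B t :=
  Finset.card_le_card (Finset.filter_subset_filter _ h)

theorem northCount_pos_iff {A : Finset (Fin n)} {t : ℕ} :
    0 < northCount A t ↔ ∃ a ∈ A, a.val < t := by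
  unfold northCount
  simp [Finset.card_pos, Finset.Nonempty]

theorem card_le_northCount_add (A : Finset (Fin n)) {t : ℕ} (ht : t ≤ n) :
    A.card ≤ northCount A t + (n - t) := by
  induction h : n - t generalizing t with
  | zero => rw [northCount_eq_card _ (by omega)]; omega
  | succ k ih =>
    have h1 := ih (t := t + 1) (by omega) (by omega)
    have h2 := northCount_succ A ⟨t, by omega⟩
    simp only at h2
    split_ifs at h2 <;> omega

theorem WeaklyBelow.antisymm {A B : Finset (Fin n)} (h : WeaklyBelow A B) (h' : WeaklyBelow B A) :
    A = B := by
  have e : ∀ t, northCount A t = northCount B t := fun t => le_antisymm (h t) (h' t)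
  ext a
  have h1 := northCount_succ A a
  have h2 := northCount_succ B a
  rw [e, e, h2] at h1
  by_cases hA : a ∈ A <;> by_cases hB : a ∈ B <;> simp_all

theorem WeaklyBelow.card_le {A B : Finset (Fin n)} (h : WeaklyBelow A B) : A.card ≤ B.card := by
  have := h n
  rwa [northCount_eq_card _ le_rfl, northCount_eq_card _ le_rfl] at this

/-- The relabelled path has an extra east step at `p`, so beyond `p` its height is the old height
one step earlier. -/
theorem northCount_map_succAbove (p : Fin (n + 1)) (A : Finset (Fin n)) (t : ℕ) :
    northCount (A.map p.succAboveEmb) t = northCount A (if t ≤ p.val then t else t - 1) := by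
  unfold northCount
  rw [Finset.filter_map, Finset.card_map]
  congr 1
  ext a
  rw [Finset.mem_filter, Finset.mem_filter]
  refine and_congr_right fun _ => ?_
  simp only [Function.comp, Fin.coe_succAboveEmb]
  rcases lt_or_ge a.castSucc p with h | h
  · rw [Fin.succAbove_of_castSucc_lt _ _ h]
    have : a.val < p.val := h
    simp only [Fin.val_castSucc]
    split_ifs <;> omega
  · rw [Fin.succAbove_of_le_castSucc _ _ h]
    have : p.val ≤ a.val := h
    simp only [Fin.val_succ]
    split_ifs <;> omega

theorem weaklyBelow_map_succAbove_iff (p : Fin (n + 1)) {A B : Finset (Fin n)} :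
    WeaklyBelow (A.map p.succAboveEmb) (B.map p.succAboveEmb) ↔ WeaklyBelow A B := by
  refine ⟨fun h t => ?_, fun h t => ?_⟩
  · by_cases ht : t ≤ p.val
    · have := h t
      simpa [northCount_map_succAbove, ht] using this
    · have := h (t + 1)
      simpa [northCount_map_succAbove, show ¬ t + 1 ≤ p.val by omega] using this
  · rw [northCount_map_succAbove, northCount_map_succAbove]
    exact h _

theorem notMem_map_succAbove (p : Fin (n + 1)) (A : Finset (Fin n)) :
    p ∉ A.map p.succAboveEmb := by
  simp

/-- Inserting a new element right after `u` turns deletion of `u` into contraction. -/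
theorem weaklyBelow_insert_map_succAbove_iff {u : Fin n} {A B : Finset (Fin n)} (hu : u ∈ B) :
    WeaklyBelow (insert u.succ (A.map u.succ.succAboveEmb)) (B.map u.succ.succAboveEmb) ↔
      WeaklyBelow A (B.erase u) := by
  refine ⟨fun h t => ?_, fun h t => ?_⟩
  · have he := northCount_erase hu t
    by_cases ht : t ≤ u.val
    · have := h t
      rw [northCount_insert (notMem_map_succAbove _ _), northCount_map_succAbove,
        northCount_map_succAbove, Fin.val_succ] at this
      split_ifs at * <;> omega
    -- Beyond `u` the relabelled paths lag by one step, so time `t` of the original paths is time `t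
    -- + 1` here.
    · have := h (t + 1)
      rw [northCount_insert (notMem_map_succAbove _ _), northCount_map_succAbove,
        northCount_map_succAbove, Fin.val_succ, if_neg (by omega), if_pos (by omega)] at this
      simp only [Nat.add_sub_cancel] at this
      split_ifs at * <;> omega
  · rw [northCount_insert (notMem_map_succAbove _ _), northCount_map_succAbove,
      northCount_map_succAbove, Fin.val_succ]
    by_cases ht : t ≤ u.val + 1
    · have h1 := h t
      have he := northCount_erase hu t
      rw [if_pos ht]
      split_ifs at * <;> omega
    · have h1 := h (t - 1)
      have he := northCount_erase hu (t - 1)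
      rw [if_neg ht]
      split_ifs at * <;> omega

/-- The north steps of the lowest path of height `k`. -/
def lowestPath (n k : ℕ) : Finset (Fin n) := Finset.univ.filter (fun a => n - k ≤ a.val)

theorem mem_lowestPath {k : ℕ} {a : Fin n} : a ∈ lowestPath n k ↔ n - k ≤ a.val := by
  simp [lowestPath]

theorem northCount_lowestPath {k t : ℕ} (ht : t ≤ n) :
    northCount (lowestPath n k) t = t - (n - k) := by
  induction t with
  | zero => simp [northCount_zero]
  | succ t ih =>
    have h := northCount_succ (lowestPath n k) ⟨t, by omega⟩
    simp only [mem_lowestPath] at h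
    rw [h, ih (by omega)]
    split_ifs <;> omega

theorem card_lowestPath {k : ℕ} (hk : k ≤ n) : (lowestPath n k).card = k := by
  rw [← northCount_eq_card _ le_rfl, northCount_lowestPath le_rfl]
  omega

/-- Only `n - t` steps remain after time `t`, so a path of height at least `k` has already climbed
`t - (n - k)`. -/
theorem weaklyBelow_lowestPath_iff {k : ℕ} (hk : k ≤ n) {B : Finset (Fin n)} :
    WeaklyBelow (lowestPath n k) B ↔ k ≤ B.card := by
  refine ⟨fun h => by simpa [card_lowestPath hk] using h.card_le, fun h t => ?_⟩
  by_cases ht : t ≤ n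
  · rw [northCount_lowestPath ht]
    have := card_le_northCount_add B ht
    omega
  · rw [northCount_eq_card _ (by omega), northCount_eq_card _ (by omega), card_lowestPath hk]
    exact h

end NorthCount

/-! ### Bases and ranks along matroid quotients. -/

namespace LPM

variable {n : ℕ}

theorem toMatroid_isBase (x : LPM n) (B : Finset (Fin n)) :
    x.toMatroid.IsBase (B : Set (Fin n)) ↔ WeaklyBelow x.L B ∧ WeaklyBelow B x.U := by
  unfold toMatroid
  rw [Matroid.ofIsBaseOfFinite_isBase]
  constructor
  · rintro ⟨C, hC, h⟩
    rw [Finset.coe_injective hC] at h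
    exact h
  · exact fun h => ⟨B, rfl, h⟩

/-- A set independent in `N / T` is independent in `N`, and being disjoint from `T` it is
independent in `N \ T`. -/
theorem exists_isBase_superset_of_le {x y : LPM n} (h : x ≤ y) {B : Finset (Fin n)}
    (hL : WeaklyBelow x.L B) (hU : WeaklyBelow B x.U) :
    ∃ C : Finset (Fin n), B ⊆ C ∧ WeaklyBelow y.L C ∧ WeaklyBelow C y.U := by
  obtain ⟨m, N, -, hy, hx⟩ := h
  have h1 := (((toMatroid_isBase x B).2 ⟨hL, hU⟩).mapEmbedding
    (Function.Embedding.inl (β := Fin m))).indep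
  rw [hx] at h1
  have h2 : (N.delete (Set.range Sum.inr)).Indep
      (Function.Embedding.inl (β := Fin m) '' (B : Set (Fin n))) := by
    refine h1.of_contract.indep_delete_of_disjoint ?_
    rw [Set.disjoint_left]
    rintro _ ⟨a, -, rfl⟩ ⟨b, hb⟩
    exact Sum.inr_ne_inl hb
  rw [← hy, Matroid.mapEmbedding_indep_iff,
    Set.preimage_image_eq _ (Function.Embedding.injective _)] at h2
  obtain ⟨C, hC, hBC⟩ := h2.1.exists_isBase_superset
  have hfin : C.Finite := Set.toFinite C
  refine ⟨hfin.toFinset, by simpa using hBC, ?_⟩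
  rw [← toMatroid_isBase]
  simpa using hC

/-- Dual to the previous lemma: a base of `N \ T` together with `T` spans `N`, so it spans `N / T`
and contains a base of it. -/
theorem exists_isBase_subset_of_le {x y : LPM n} (h : x ≤ y) {C : Finset (Fin n)}
    (hL : WeaklyBelow y.L C) (hU : WeaklyBelow C y.U) :
    ∃ B : Finset (Fin n), B ⊆ C ∧ WeaklyBelow x.L B ∧ WeaklyBelow B x.U := by
  obtain ⟨m, N, hN, hy, hx⟩ := h
  have h1 := ((toMatroid_isBase y C).2 ⟨hL, hU⟩).mapEmbedding (Function.Embedding.inl (β := Fin m))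
  rw [hy, Matroid.delete_isBase_iff] at h1
  set X := Function.Embedding.inl (β := Fin m) '' (C : Set (Fin n)) with hX
  have h2 : (N.contract (Set.range Sum.inr)).Spanning X := by
    rw [Matroid.contract_spanning_iff (by rw [hN]; exact Set.subset_univ _)]
    constructor
    · rw [Matroid.spanning_iff_ground_subset_closure (by rw [hN]; exact Set.subset_univ _)]
      intro e he
      by_cases heT : e ∈ Set.range Sum.inr
      · exact N.mem_closure_of_mem (Or.inr heT) (by rw [hN]; exact Set.subset_univ _)
      · exact N.closure_subset_closure Set.subset_union_left (h1.subset_closure ⟨he, heT⟩)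
    · rw [Set.disjoint_left]
      rintro _ ⟨a, -, rfl⟩ ⟨b, hb⟩
      exact Sum.inr_ne_inl hb
  rw [← hx] at h2
  obtain ⟨B, hB, hBX⟩ := h2.exists_isBase_subset
  rw [Matroid.mapEmbedding_isBase_iff] at hB
  have hfin := Set.toFinite (Function.Embedding.inl (β := Fin m) ⁻¹' B)
  refine ⟨hfin.toFinset, ?_, ?_⟩
  · intro a ha
    have := hBX (by simpa using ha : Function.Embedding.inl (β := Fin m) a ∈ B)
    simpa [hX] using this
  · rw [← toMatroid_isBase]
    simpa using hB.1

theorem card_le_of_le {x y : LPM n} (h : x ≤ y) : x.U.card ≤ y.U.card := by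
  obtain ⟨C, h1, -, h3⟩ := exists_isBase_superset_of_le h x.noncrossing (fun _ => le_rfl)
  exact (Finset.card_le_card h1).trans h3.card_le

/-- At equal rank, extending or shrinking a base does nothing, so both matroids have the same bases.
The diagram is recovered from these, as its two paths are the extreme bases. -/
theorem eq_of_le_of_card_eq {x y : LPM n} (h : x ≤ y) (hc : x.U.card = y.U.card) : x = y := by
  have key : ∀ B, WeaklyBelow x.L B → WeaklyBelow B x.U → WeaklyBelow y.L B ∧ WeaklyBelow B y.U := by
    intro B hL hU
    obtain ⟨C, h1, h2, h3⟩ := exists_isBase_superset_of_le h hL hU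
    have h4 := hL.card_le
    have h5 := x.card_eq
    have h6 := h3.card_le
    rw [Finset.eq_of_subset_of_card_le h1 (by omega)]
    exact ⟨h2, h3⟩
  have key' : ∀ C, WeaklyBelow y.L C → WeaklyBelow C y.U → WeaklyBelow x.L C ∧ WeaklyBelow C x.U := by
    intro C hL hU
    obtain ⟨B, h1, h2, h3⟩ := exists_isBase_subset_of_le h hL hU
    have h4 := h2.card_le
    have h5 := x.card_eq
    have h6 := hU.card_le
    rw [← Finset.eq_of_subset_of_card_le h1 (by omega)]
    exact ⟨h2, h3⟩
  have refl : ∀ A : Finset (Fin n), WeaklyBelow A A := fun _ _ => le_rfl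
  ext1
  · exact (key _ x.noncrossing (refl _)).2.antisymm (key' _ y.noncrossing (refl _)).2
  · exact (key' _ (refl _) y.noncrossing).1.antisymm (key _ (refl _) x.noncrossing).1

theorem covBy_of_le {x y : LPM n} (h : x ≤ y) (hc : x.U.card + 1 = y.U.card) : x ⋖ y := by
  refine ⟨⟨h, fun e => by rw [e] at hc; omega⟩, ?_⟩
  rintro z ⟨h1, h2⟩ ⟨h3, h4⟩
  have h5 := card_le_of_le h1
  have h6 := card_le_of_le h3
  have h7 : x.U.card ≠ z.U.card := fun e => h2 (eq_of_le_of_card_eq h1 e)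
  have h8 : z.U.card ≠ y.U.card := fun e => h4 (eq_of_le_of_card_eq h3 e)
  omega

/-! ### One-element extensions from exchange families. -/

/-- The exchange property for a family of finite sets. -/
def Exchange {α : Type*} [DecidableEq α] (F : Finset α → Prop) : Prop :=
  ∀ A B, F A → F B → ∀ a ∈ A, a ∉ B → ∃ b ∈ B, b ∉ A ∧ F (insert b (A.erase a))

/-- A family with the exchange property on the ground set extended by one element `p` exhibits a
matroid quotient. -/
theorem le_of_exchange {x y : LPM n} (p : Fin (n + 1)) (F : Finset (Fin (n + 1)) → Prop)
    (hF : Exchange F)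
    (hy : ∀ B : Finset (Fin n), F (B.map p.succAboveEmb) ↔
      WeaklyBelow y.L B ∧ WeaklyBelow B y.U)
    (hx : ∀ B : Finset (Fin n), F (insert p (B.map p.succAboveEmb)) ↔
      WeaklyBelow x.L B ∧ WeaklyBelow B x.U) : x ≤ y := by
  classical
  have hbij : Function.Bijective (Sum.elim p.succAbove (fun _ : Fin 1 => p)) := by
    constructor
    · rintro (a | a) (b | b) h
      · simpa using h
      · exact absurd h (Fin.succAbove_ne p a)
      · exact absurd h.symm (Fin.succAbove_ne p b)
      · rw [Subsingleton.elim a b]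
    · intro a
      by_cases ha : a = p
      · exact ⟨Sum.inr 0, ha.symm⟩
      · obtain ⟨b, rfl⟩ := Fin.exists_succAbove_eq ha
        exact ⟨Sum.inl b, rfl⟩
  let f : Fin n ⊕ Fin 1 ≃ Fin (n + 1) := Equiv.ofBijective _ hbij
  let P : Set (Fin n ⊕ Fin 1) → Prop := fun S => ∃ B : Finset (Fin (n + 1)), f '' S = B ∧ F B
  have hPex : Matroid.ExchangeProperty P := by
    rintro X Y ⟨A, hA, hFA⟩ ⟨B, hB, hFB⟩ a ⟨ha, ha'⟩
    have hmA : ∀ z, f z ∈ A ↔ z ∈ X := fun z => by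
      rw [← Finset.mem_coe, ← hA]; exact f.injective.mem_set_image
    have hmB : ∀ z, f z ∈ B ↔ z ∈ Y := fun z => by
      rw [← Finset.mem_coe, ← hB]; exact f.injective.mem_set_image
    obtain ⟨b, hbB, hbA, hb⟩ := hF A B hFA hFB (f a) ((hmA a).2 ha) (fun h => ha' ((hmB a).1 h))
    obtain ⟨b, rfl⟩ := f.surjective b
    refine ⟨b, ⟨(hmB b).1 hbB, fun h => hbA ((hmA b).2 h)⟩, _, ?_, hb⟩
    rw [Set.image_insert_eq, Set.image_sdiff f.injective, hA]
    simp
  have hPl : ∀ S : Set (Fin n), P (Sum.inl '' S) ↔ y.toMatroid.IsBase S := by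
    intro S
    have hS := S.toFinite
    have e : f '' (Sum.inl '' S) = (hS.toFinset.map p.succAboveEmb : Finset _) := by
      rw [Set.image_image]; simp [f]
    have e2 : y.toMatroid.IsBase S ↔ F (hS.toFinset.map p.succAboveEmb) := by
      rw [hy, ← toMatroid_isBase, hS.coe_toFinset]
    rw [e2]
    constructor
    · rintro ⟨B, hB, h⟩
      rw [e] at hB
      rwa [Finset.coe_injective hB]
    · exact fun h => ⟨_, e, h⟩
  have hPr : ∀ S : Set (Fin n), P (insert (Sum.inr 0) (Sum.inl '' S)) ↔ x.toMatroid.IsBase S := by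
    intro S
    have hS := S.toFinite
    have e : f '' (insert (Sum.inr 0) (Sum.inl '' S)) =
        (insert p (hS.toFinset.map p.succAboveEmb) : Finset _) := by
      rw [Set.image_insert_eq, Set.image_image]; simp [f]
    have e2 : x.toMatroid.IsBase S ↔ F (insert p (hS.toFinset.map p.succAboveEmb)) := by
      rw [hx, ← toMatroid_isBase, hS.coe_toFinset]
    rw [e2]
    constructor
    · rintro ⟨B, hB, h⟩
      rw [e] at hB
      rwa [Finset.coe_injective hB]
    · exact fun h => ⟨_, e, h⟩
  obtain ⟨By, hBy⟩ := y.toMatroid.exists_isBase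
  obtain ⟨Bx, hBx⟩ := x.toMatroid.exists_isBase
  let N : Matroid (Fin n ⊕ Fin 1) := Matroid.ofIsBaseOfFinite (E := Set.univ) Set.finite_univ P
    ⟨_, (hPl By).2 hBy⟩ hPex (fun _ _ => Set.subset_univ _)
  have hNb : ∀ S, N.IsBase S ↔ P S := fun S => Iff.rfl
  have hT : Set.range (Sum.inr : Fin 1 → Fin n ⊕ Fin 1) = {Sum.inr 0} := by
    ext z
    simp only [Set.mem_range, Set.mem_singleton_iff]
    exact ⟨fun ⟨a, ha⟩ => by rw [← ha, Subsingleton.elim a 0], fun h => ⟨0, h.symm⟩⟩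
  have hinl : ∀ S : Set (Fin n ⊕ Fin 1), Sum.inr 0 ∉ S → Sum.inl '' (Sum.inl ⁻¹' S) = S := by
    intro S hS
    rw [Set.image_preimage_eq_iff]
    rintro (a | a) ha
    · exact ⟨a, rfl⟩
    · rw [Subsingleton.elim a 0] at ha
      exact absurd ha hS
  have hground : (Function.Embedding.inl (β := Fin 1)) '' (Set.univ : Set (Fin n)) =
      N.E \ {Sum.inr 0} := by
    have : N.E = Set.univ := rfl
    rw [this]
    ext (a | a)
    · simp
    · simp [Subsingleton.elim a 0]
  refine ⟨1, N, rfl, ?_, ?_⟩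
  · rw [hT]
    refine Matroid.ext_isBase hground fun S hS => ?_
    have hS0 : Sum.inr 0 ∉ S := by
      intro h
      obtain ⟨a, -, ha⟩ := hS h
      exact Sum.inl_ne_inr ha
    -- Bases of `y` avoid the new element, so it is not a coloop and the bases of the deletion are
    -- the bases of `N` avoiding it. Dually, bases of `x` show below that it is not a loop.
    have hco : N.Coindep {Sum.inr 0} := by
      rw [Matroid.coindep_iff_exists]
      refine ⟨_, (hPl By).2 hBy, ?_⟩
      rintro _ ⟨a, -, rfl⟩
      exact ⟨Set.mem_univ _, by simp⟩
    rw [Matroid.mapEmbedding_isBase_iff, hco.delete_isBase_iff, hNb, ← hPl]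
    change P (Sum.inl '' (Sum.inl ⁻¹' S)) ∧ _ ↔ _
    rw [hinl S hS0]
    simp only [Set.disjoint_singleton_right, hS0, not_false_eq_true, and_true, and_iff_left_iff_imp]
    exact fun _ z hz => by obtain ⟨a, -, ha⟩ := hS hz; exact ⟨a, ha⟩
  · rw [hT]
    refine Matroid.ext_isBase hground fun S hS => ?_
    have hS0 : Sum.inr 0 ∉ S := by
      intro h
      obtain ⟨a, -, ha⟩ := hS h
      exact Sum.inl_ne_inr ha
    have hind : N.Indep {Sum.inr 0} :=
      Matroid.IsBase.indep (B := insert (Sum.inr 0) (Sum.inl '' Bx)) ((hPr Bx).2 hBx) |>.subset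
        (by simp)
    rw [Matroid.mapEmbedding_isBase_iff, hind.contract_isBase_iff, hNb, ← hPr]
    change P (insert (Sum.inr 0) (Sum.inl '' (Sum.inl ⁻¹' S))) ∧ _ ↔ _
    rw [hinl S hS0, Set.union_singleton]
    simp only [Set.disjoint_singleton_right, hS0, not_false_eq_true, and_true, and_iff_left_iff_imp]
    exact fun _ z hz => by obtain ⟨a, -, ha⟩ := hS hz; exact ⟨a, ha⟩

/-- With the lowest path of height `k` as lower path, the lower bound is vacuous, so this is base
exchange in a lattice path matroid. -/
theorem exchange_weaklyBelow {V : Finset (Fin n)} {k : ℕ} (hk : V.card = k) :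
    Exchange (fun A => A.card = k ∧ WeaklyBelow A V) := by
  have hkn : k ≤ n := by simpa [hk] using V.card_le_univ
  let x : LPM n := ⟨V, lowestPath n k, by rw [card_lowestPath hkn, hk],
    (weaklyBelow_lowestPath_iff hkn).2 hk.ge⟩
  rintro A B ⟨hA, hAV⟩ ⟨hB, hBV⟩ a ha haB
  obtain ⟨b, ⟨hb, hbA⟩, C, hC, -, hCV⟩ := x.isBase_exchange A B
    ⟨A, rfl, (weaklyBelow_lowestPath_iff hkn).2 hA.ge, hAV⟩
    ⟨B, rfl, (weaklyBelow_lowestPath_iff hkn).2 hB.ge, hBV⟩ a (by simp [ha, haB])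
  have hbA : b ∉ A := by simpa using hbA
  have : C = insert b (A.erase a) := Finset.coe_injective (by rw [hC]; simp)
  subst this
  have h1 := Finset.card_erase_add_one ha
  refine ⟨b, by simpa using hb, hbA, ?_, hCV⟩
  rw [Finset.card_insert_of_notMem (by simp [hbA])]
  omega

/-- Removing one base `X` keeps the exchange property if every exchange that is possible at some
`y ∈ X` is possible at `y` with every element outside `X` that lies in some base. -/
theorem Exchange.erase_base {α : Type*} [DecidableEq α] {F : Finset α → Prop} {k : ℕ}
    (hF : Exchange F) (hk : ∀ A, F A → A.card = k) {X : Finset α} (hX : X.card = k)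
    (h : ∀ y ∈ X, ∀ x ∉ X, F (insert x (X.erase y)) → ∀ x' ∉ X, ∀ B, F B → x' ∈ B →
      F (insert x' (X.erase y))) :
    Exchange (fun A => F A ∧ A ≠ X) := by
  rintro A B ⟨hA, hAX⟩ ⟨hB, hBX⟩ a ha haB
  obtain ⟨b, hb, hbA, hab⟩ := hF A B hA hB a ha haB
  by_cases he : insert b (A.erase a) = X
  · have hba : b ≠ a := by rintro rfl; exact haB hb
    have hbX : b ∈ X := by rw [← he]; simp
    have haX : a ∉ X := by
      rw [← he]; simp [hba.symm]
    have hXb : X.erase b = A.erase a := by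
      rw [← he, Finset.erase_insert (by simp [hbA])]
    have hAe : insert a (X.erase b) = A := by rw [hXb, Finset.insert_erase ha]
    -- The exchange landed on the forbidden set, so `A` differs from `X` by one exchange at `b`.
    -- Since `B` is another set of the same size, it offers an element outside `X` to bring in
    -- instead of `b`.
    obtain ⟨x', hx'B, hx'X⟩ : ∃ x' ∈ B, x' ∉ X := by
      by_contra! hcon
      exact hBX (Finset.eq_of_subset_of_card_le hcon (by rw [hX, hk B hB]))
    have hx'A : x' ∉ A := by
      rw [← hAe]
      simp only [Finset.mem_insert, Finset.mem_erase, not_or, not_and]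
      exact ⟨by rintro rfl; exact haB hx'B, fun _ => hx'X⟩
    refine ⟨x', hx'B, hx'A, ?_, ?_⟩
    · rw [← hXb]
      exact h b hbX a haX (by rwa [hAe]) x' hx'X B hB hx'B
    · intro e
      exact hx'X (by rw [← e]; simp)
  · exact ⟨b, hb, hbA, hab, he⟩

end LPM

/-! ### Moving one north step. -/

section

variable {n : ℕ}

theorem northCount_compl (A : Finset (Fin n)) {t : ℕ} (ht : t ≤ n) :
    northCount A t + northCount Aᶜ t = t := by
  induction t with
  | zero => simp [northCount_zero]
  | succ t ih =>
    have h1 := northCount_succ A ⟨t, by omega⟩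
    have h2 := northCount_succ Aᶜ ⟨t, by omega⟩
    have h3 := ih (by omega)
    simp only [Finset.mem_compl] at h1 h2
    by_cases h : (⟨t, by omega⟩ : Fin n) ∈ A <;> simp [h] at h1 h2 <;> omega

theorem northCount_eq_card_of_forall_lt {A : Finset (Fin n)} {t : ℕ}
    (h : ∀ a ∈ A, a.val < t) : northCount A t = A.card := by
  unfold northCount
  rw [Finset.filter_true_of_mem h]

theorem northCount_eq_zero_of_forall_le {A : Finset (Fin n)} {t : ℕ}
    (h : ∀ a ∈ A, t ≤ a.val) : northCount A t = 0 := by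
  unfold northCount
  rw [Finset.card_eq_zero, Finset.filter_eq_empty_iff]
  intro a ha
  exact not_lt.2 (h a ha)

/-- Moving a north step from `y` to `x` raises the path by one exactly at times `t` with `x < t ≤
y`; only contact with `V` at such a time can obstruct. -/
theorem weaklyBelow_insert_erase {X V : Finset (Fin n)} (hXV : WeaklyBelow X V) {x y : Fin n}
    (hy : y ∈ X) (hx : x ∉ X)
    (h : ∀ t, x.val < t → t ≤ y.val → northCount X t ≠ northCount V t) :
    WeaklyBelow (insert x (X.erase y)) V := by
  intro t
  have h1 := northCount_exchange X hy hx t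
  have h2 := hXV t
  by_cases hxt : x.val < t
  · by_cases hyt : t ≤ y.val
    · have := h t hxt hyt
      split_ifs at h1 <;> omega
    · split_ifs at h1 <;> omega
  · split_ifs at h1 <;> omega

theorem le_of_weaklyBelow_insert_erase {X V : Finset (Fin n)} {x y : Fin n}
    (hy : y ∈ X) (hx : x ∉ X) (h : WeaklyBelow (insert x (X.erase y)) V) {t : ℕ} (ht : t ≤ y.val)
    (hXV : northCount X t = northCount V t) : t ≤ x.val := by
  have h1 := northCount_exchange X hy hx t
  have h2 := h t
  split_ifs at h1 <;> omega

/-- The second lowest path exceeds the lowest only at time `i`, with height `1` instead of `0`. A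
path of height `n - i` that is still at `0` then must go north ever after, so it is the lowest one.
-/
theorem weaklyBelow_insert_erase_lowestPath_iff {i : ℕ} (hi : 1 ≤ i) (hin : i < n)
    {B : Finset (Fin n)} (hB : B.card = n - i) :
    WeaklyBelow (insert ⟨i - 1, by omega⟩ ((lowestPath n (n - i)).erase ⟨i, hin⟩)) B ↔
      B ≠ lowestPath n (n - i) := by
  have hex := northCount_exchange (lowestPath n (n - i)) (x := ⟨i, hin⟩) (y := ⟨i - 1, by omega⟩)
    (mem_lowestPath.2 (by simp; omega)) (by rw [mem_lowestPath]; simp; omega)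
  have hlow := (weaklyBelow_lowestPath_iff (n := n) (k := n - i) (by omega)).2 hB.ge
  constructor
  · rintro h rfl
    have h1 := h i
    have h2 := hex i
    simp only [lt_irrefl, if_false, show i - 1 < i by omega, if_true] at h2
    omega
  · intro h t
    have h1 := hex t
    have h2 := hlow t
    simp only at h1
    by_cases ht : t = i
    · subst ht
      have h0 : northCount (lowestPath n (n - t)) t = 0 := by
        rw [northCount_lowestPath (by omega)]; omega
      have : 0 < northCount B t := by
        rw [northCount_pos_iff]
        by_contra! hcon
        refine h (Finset.eq_of_subset_of_card_le (fun a ha => ?_) ?_)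
        · have := hcon a ha
          rw [mem_lowestPath]; omega
        · rw [card_lowestPath (by omega), hB]
      split_ifs at h1 <;> omega
    · split_ifs at h1 <;> omega

end

/-! ### Three sufficient conditions for a quotient step. -/

namespace LPM

variable {n : ℕ}

/-- The extension consists of all paths of the right height below `y.U`, relabelled with an extra
position just after `u`. A path using that position leaves room exactly for a path below `y.U.erase
u`. -/
theorem le_of_erase {x y : LPM n} {u : Fin n} (hu : u ∈ y.U) (hxU : x.U = y.U.erase u)
    (hy : ∀ B : Finset (Fin n), B.card = y.U.card → WeaklyBelow y.L B)
    (hx : ∀ B : Finset (Fin n), B.card = x.U.card → WeaklyBelow x.L B) : x ≤ y := by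
  have hc := Finset.card_erase_add_one hu
  rw [← hxU] at hc
  refine le_of_exchange u.succ _
    (exchange_weaklyBelow (V := y.U.map u.succ.succAboveEmb) (by rw [Finset.card_map]))
    (fun B => ?_) (fun B => ?_)
  · rw [weaklyBelow_map_succAbove_iff, Finset.card_map]
    refine and_congr_left fun h => ⟨hy B, fun h' => ?_⟩
    exact le_antisymm h.card_le (y.card_eq.ge.trans h'.card_le)
  · rw [weaklyBelow_insert_map_succAbove_iff hu, ← hxU,
      Finset.card_insert_of_notMem (notMem_map_succAbove _ _), Finset.card_map, ← hc,
      Nat.add_right_cancel_iff]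
    refine and_congr_left fun h => ⟨hx B, fun h' => ?_⟩
    exact le_antisymm h.card_le (x.card_eq.ge.trans h'.card_le)

/-- A quotient step into the interval without its lowest path. -/
theorem le_of_erase_of_ne_lowestPath {x y : LPM n} {u : Fin n} (hu : u ∈ y.U)
    (hxU : x.U = y.U.erase u)
    (hy : ∀ B : Finset (Fin n), B.card = y.U.card →
      (WeaklyBelow y.L B ↔ B ≠ lowestPath n y.U.card))
    (hx : ∀ B : Finset (Fin n), B.card = x.U.card → WeaklyBelow x.L B)
    (hq : ∃ q ∉ y.U, u < q) : x ≤ y := by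
  obtain ⟨q, hqU, huq⟩ := hq
  have hc := Finset.card_erase_add_one hu
  rw [← hxU] at hc
  generalize hk : y.U.card = k at *
  have hkn : k ≤ n := by simpa [hk] using y.U.card_le_univ
  set p := u.succ with hp
  set V := y.U.map p.succAboveEmb with hV
  -- This base of the extension avoids `p`, so removing it changes the deletion and leaves the
  -- contraction intact.
  set X := (lowestPath n k).map p.succAboveEmb with hX
  have hXk : X.card = k := by rw [hX, Finset.card_map, card_lowestPath hkn]
  have hXV : WeaklyBelow X V := by
    rw [weaklyBelow_map_succAbove_iff, weaklyBelow_lowestPath_iff hkn, hk]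
  have hexch : Exchange (fun A => (A.card = k ∧ WeaklyBelow A V) ∧ A ≠ X) := by
    refine (exchange_weaklyBelow (V := V) (k := k) (by rw [hV, Finset.card_map, hk])).erase_base
      (fun A hA => hA.1) hXk ?_
    rintro b hb a ha ⟨-, hab⟩ a' ha' B ⟨-, hBV⟩ ha'B
    have hcard := Finset.card_erase_add_one hb
    refine ⟨by rw [Finset.card_insert_of_notMem (by simp [ha'])]; omega, ?_⟩
    refine weaklyBelow_insert_erase hXV hb ha' fun t h1 h2 htight => ?_
    have h3 := le_of_weaklyBelow_insert_erase hb ha hab h2 htight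
    have h4 : 0 < northCount V t :=
      (northCount_pos_iff.2 ⟨a', ha'B, h1⟩).trans_le (hBV t)
    have hbn := b.2
    rw [hX, hV, northCount_map_succAbove, northCount_map_succAbove,
      northCount_lowestPath (by split_ifs <;> omega)] at htight
    rw [hV, northCount_map_succAbove] at h4
    -- A contact time `t` would satisfy `t ≤ a`. If `a = p`, contact at positive height forces `y.U`
    -- to contain every position from `t` on, contrary to `q`. Otherwise `X` is still at height `0`
    -- at time `t`, while `V` is not.
    by_cases hap : a = p
    · subst hap
      rw [if_pos h3] at htight h4
      have hau : p.val = u.val + 1 := by rw [hp]; rfl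
      have huq' : u.val < q.val := huq
      have h5 := card_le_northCount_add (insert q y.U) (t := t) (by omega)
      rw [Finset.card_insert_of_notMem hqU, northCount_insert hqU, if_neg (by omega)] at h5
      omega
    · obtain ⟨z, rfl⟩ := Fin.exists_succAbove_eq hap
      have hz : ¬ n - k ≤ z.val := by
        rw [← mem_lowestPath]
        intro hz
        exact ha (Finset.mem_map_of_mem p.succAboveEmb hz)
      have h6 : (p.succAbove z).val ≤ z.val + 1 := by
        unfold Fin.succAbove
        split_ifs <;> simp
      split_ifs at * <;> omega
  refine le_of_exchange p _ hexch (fun B => ?_) (fun B => ?_)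
  · rw [weaklyBelow_map_succAbove_iff, Finset.card_map, hX, Ne,
      (Finset.map_injective p.succAboveEmb).eq_iff]
    constructor
    · rintro ⟨⟨h1, h2⟩, h3⟩
      exact ⟨(hy B h1).2 h3, h2⟩
    · rintro ⟨h1, h2⟩
      have h3 : B.card = k :=
        le_antisymm (hk ▸ h2.card_le) (by rw [← hk, ← y.card_eq]; exact h1.card_le)
      exact ⟨⟨h3, h2⟩, (hy B h3).1 h1⟩
  · rw [weaklyBelow_insert_map_succAbove_iff hu, ← hxU,
      Finset.card_insert_of_notMem (notMem_map_succAbove _ _), Finset.card_map]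
    constructor
    · rintro ⟨⟨h1, h2⟩, -⟩
      exact ⟨hx B (by omega), h2⟩
    · rintro ⟨h1, h2⟩
      have h3 := h1.card_le
      have h4 := h2.card_le
      have h5 := x.card_eq
      refine ⟨⟨by omega, h2⟩, fun e => notMem_map_succAbove p (lowestPath n k) ?_⟩
      rw [← hX, ← e]
      simp

/-- A quotient step out of the interval without its lowest path. -/
theorem ne_lowestPath_le_of_erase {x y : LPM n} {u : Fin n} (hu : u ∈ y.U)
    (hxU : x.U = y.U.erase u)
    (hy : ∀ B : Finset (Fin n), B.card = y.U.card → WeaklyBelow y.L B)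
    (hx : ∀ B : Finset (Fin n), B.card = x.U.card →
      (WeaklyBelow x.L B ↔ B ≠ lowestPath n x.U.card))
    (hq : ∃ q ∈ y.U, q < u) : x ≤ y := by
  obtain ⟨q, hqU, huq⟩ := hq
  have hc := Finset.card_erase_add_one hu
  rw [← hxU] at hc
  generalize hk : x.U.card = k at *
  have hkn : k + 1 ≤ n := by simpa [← hc] using y.U.card_le_univ
  set p := u.succ with hp
  have hpu : p.val = u.val + 1 := by rw [hp]; rfl
  set V := y.U.map p.succAboveEmb with hV
  -- This base contains `p`, so its removal affects only the contraction.
  set X := insert p ((lowestPath n k).map p.succAboveEmb) with hX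
  have hXk : X.card = k + 1 := by
    rw [hX, Finset.card_insert_of_notMem (notMem_map_succAbove _ _), Finset.card_map,
      card_lowestPath (by omega)]
  have hXV : WeaklyBelow X V := by
    rw [weaklyBelow_insert_map_succAbove_iff hu, weaklyBelow_lowestPath_iff (by omega), ← hxU, hk]
  have hexch : Exchange (fun A => (A.card = k + 1 ∧ WeaklyBelow A V) ∧ A ≠ X) := by
    refine (exchange_weaklyBelow (V := V) (k := k + 1)
      (by rw [hV, Finset.card_map, hc])).erase_base (fun A hA => hA.1) hXk ?_
    rintro b hb a ha ⟨-, hab⟩ a' ha' B ⟨-, hBV⟩ ha'B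
    have hcard := Finset.card_erase_add_one hb
    refine ⟨by rw [Finset.card_insert_of_notMem (by simp [ha'])]; omega, ?_⟩
    refine weaklyBelow_insert_erase hXV hb ha' fun t h1 h2 htight => ?_
    have h3 := le_of_weaklyBelow_insert_erase hb ha hab h2 htight
    have h4 : 0 < northCount V t :=
      (northCount_pos_iff.2 ⟨a', ha'B, h1⟩).trans_le (hBV t)
    have hbn := b.2
    have hap : a ≠ p := by rintro rfl; exact ha (by simp [hX])
    obtain ⟨z, rfl⟩ := Fin.exists_succAbove_eq hap
    have hz : ¬ n - k ≤ z.val := by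
      rw [← mem_lowestPath]
      intro hz
      exact ha (Finset.mem_insert_of_mem (Finset.mem_map_of_mem p.succAboveEmb hz))
    have h6 : (p.succAbove z).val ≤ z.val + 1 := by
      unfold Fin.succAbove
      split_ifs <;> simp
    rw [hX, hV, northCount_insert (notMem_map_succAbove _ _), northCount_map_succAbove,
      northCount_map_succAbove, northCount_lowestPath (by split_ifs <;> omega)] at htight
    rw [hV, northCount_map_succAbove] at h4
    by_cases htp : t ≤ p.val
    · rw [if_pos htp, if_neg (by omega)] at htight
      rw [if_pos htp] at h4
      omega
    · rw [if_neg htp, if_pos (by omega)] at htight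
      -- Here `X` has height `1`, coming from `p` alone, but `V` has already taken the steps from
      -- both `q` and `u`.
      have huq' : q.val < u.val := huq
      have h7 : 0 < northCount (y.U.erase u) (t - 1) :=
        northCount_pos_iff.2 ⟨q, Finset.mem_erase.2 ⟨huq.ne, hqU⟩, by omega⟩
      have h8 := northCount_erase hu (t - 1)
      rw [if_pos (by omega)] at h8
      omega
  refine le_of_exchange p _ hexch (fun B => ?_) (fun B => ?_)
  · rw [weaklyBelow_map_succAbove_iff, Finset.card_map]
    constructor
    · rintro ⟨⟨h1, h2⟩, -⟩
      exact ⟨hy B (by omega), h2⟩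
    · rintro ⟨h1, h2⟩
      have h3 := h1.card_le
      have h4 := h2.card_le
      have h5 := y.card_eq
      refine ⟨⟨by omega, h2⟩, fun e => notMem_map_succAbove p B ?_⟩
      rw [e]
      simp [hX]
  · rw [weaklyBelow_insert_map_succAbove_iff hu, ← hxU,
      Finset.card_insert_of_notMem (notMem_map_succAbove _ _), Finset.card_map,
      Nat.add_right_cancel_iff]
    have hne : insert p (B.map p.succAboveEmb) ≠ X ↔ B ≠ lowestPath n k := by
      rw [not_iff_not]
      constructor
      · intro e
        have := congrArg (fun S => S.erase p) e
        simp only [hX] at this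
        rw [Finset.erase_insert (notMem_map_succAbove _ _),
          Finset.erase_insert (notMem_map_succAbove _ _)] at this
        exact Finset.map_injective _ this
      · rintro rfl
        rfl
    rw [hne]
    constructor
    · rintro ⟨⟨h1, h2⟩, h3⟩
      exact ⟨(hx B h1).2 h3, h2⟩
    · rintro ⟨h1, h2⟩
      have h3 := h1.card_le
      have h4 := h2.card_le
      have h5 := x.card_eq
      have h6 : B.card = k := by omega
      exact ⟨⟨h6, h2⟩, (hx B h6).1 h1⟩

end LPM

/-! ### Chains as pairs of permutations. -/

namespace LPM

variable {n : ℕ}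

/-- The set of the first `j` values of a permutation. -/
def prefixSet (π : Equiv.Perm (Fin n)) (j : ℕ) : Finset (Fin n) :=
  Finset.univ.filter (fun a => (π.symm a).val < j)

@[simp]
theorem mem_prefixSet {π : Equiv.Perm (Fin n)} {j : ℕ} {a : Fin n} :
    a ∈ prefixSet π j ↔ (π.symm a).val < j := by
  simp [prefixSet]

theorem prefixSet_succ (π : Equiv.Perm (Fin n)) (j : Fin n) :
    prefixSet π (j.val + 1) = insert (π j) (prefixSet π j.val) := by
  ext a
  rw [Finset.mem_insert, mem_prefixSet, mem_prefixSet, ← π.symm_apply_eq, Fin.ext_iff]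
  omega

theorem notMem_prefixSet (π : Equiv.Perm (Fin n)) (j : Fin n) : π j ∉ prefixSet π j.val := by
  simp

theorem prefixSet_eq_erase (π : Equiv.Perm (Fin n)) (j : Fin n) :
    prefixSet π j.val = (prefixSet π (j.val + 1)).erase (π j) := by
  rw [prefixSet_succ, Finset.erase_insert (notMem_prefixSet π j)]

theorem prefixSet_zero (π : Equiv.Perm (Fin n)) : prefixSet π 0 = ∅ := by
  ext a; simp

theorem prefixSet_self (π : Equiv.Perm (Fin n)) : prefixSet π n = Finset.univ := by
  ext a; simp

theorem card_prefixSet (π : Equiv.Perm (Fin n)) {j : ℕ} (hj : j ≤ n) : (prefixSet π j).card = j := by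
  induction j with
  | zero => simp [prefixSet_zero]
  | succ j ih =>
    have := prefixSet_succ π ⟨j, hj⟩
    simp only at this
    rw [this, Finset.card_insert_of_notMem (notMem_prefixSet π ⟨j, hj⟩), ih (by omega)]

theorem prefixSet_sdiff (π : Equiv.Perm (Fin n)) (j : Fin n) :
    prefixSet π (j.val + 1) \ prefixSet π j.val = {π j} := by
  rw [prefixSet_succ, Finset.insert_sdiff_of_notMem _ (notMem_prefixSet π j), sdiff_self]
  rfl

/-- The differences alone do not say that the sets increase. An element can enter only at its own
step, so once missing after that step it never returns, which is impossible because the last set is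
everything. -/
theorem eq_prefixSet_of_sdiff {S : Fin (n + 1) → Finset (Fin n)} {π : Equiv.Perm (Fin n)}
    (h0 : S 0 = ∅) (hn : S (Fin.last n) = Finset.univ)
    (h : ∀ j : Fin n, S j.succ \ S j.castSucc = {π j}) (j : Fin (n + 1)) :
    S j = prefixSet π j.val := by
  have hmem : ∀ (j : Fin n) (a : Fin n), a ∈ S j.succ → a ∉ S j.castSucc → a = π j := by
    intro j a h1 h2
    have : a ∈ S j.succ \ S j.castSucc := by simp [h1, h2]
    rw [h j] at this
    simpa using this
  ext a
  rw [mem_prefixSet]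
  constructor
  · induction j using Fin.induction with
    | zero => simp [h0]
    | succ j ih =>
      intro ha
      by_cases hja : a ∈ S j.castSucc
      · have := ih hja
        simp only [Fin.val_castSucc, Fin.val_succ] at *
        omega
      · rw [hmem j a ha hja]
        simp
  · intro hlt
    by_contra ha
    have key : ∀ k : Fin (n + 1), j ≤ k → a ∉ S k := by
      intro k
      induction k using Fin.induction with
      | zero =>
        intro hjk
        rw [h0]; simp
      | succ k ih =>
        intro hjk hak
        rcases eq_or_lt_of_le hjk with rfl | hjk'
        · exact ha hak
        · have hjk2 : j ≤ k.castSucc := Fin.le_castSucc_iff.2 hjk'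
          have := hmem k a hak (ih hjk2)
          subst this
          rw [Equiv.symm_apply_apply] at hlt
          have : j.val ≤ k.val := hjk2
          omega
    exact key (Fin.last n) (Fin.le_last j) (by rw [hn]; simp)

theorem eq_prefixSet {c : Fin (n + 1) → LPM n} {σ τ : Equiv.Perm (Fin n)} (hc : IsMaximalChain c)
    (h : HasLabels c σ τ) (j : Fin (n + 1)) :
    (c j).L = prefixSet σ j.val ∧ (c j).U = prefixSet τ j.val := by
  obtain ⟨h0, hn, -⟩ := hc
  constructor
  · exact eq_prefixSet_of_sdiff (S := fun j => (c j).L) (by simp [h0, bottom])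
      (by simp [hn, top]) (fun j => (h j).1) j
  · exact eq_prefixSet_of_sdiff (S := fun j => (c j).U) (by simp [h0, bottom])
      (by simp [hn, top]) (fun j => (h j).2) j

theorem labels_unique {c : Fin (n + 1) → LPM n} {σ τ τ' : Equiv.Perm (Fin n)}
    (h : HasLabels c σ τ) (h' : HasLabels c σ τ') : τ = τ' := by
  ext1 j
  have h1 := (h j).2
  rw [(h' j).2] at h1
  exact (Finset.singleton_injective h1).symm

/-- The permutations that occur as upper-path labels of the falling chains with lower-path
permutation `s_i w₀`, where `m = n - i`. -/
def IsAdmissible (m : ℕ) (τ : Equiv.Perm (Fin n)) (hm : m < n) : Prop :=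
  τ ⟨m, hm⟩ < τ ⟨m - 1, by omega⟩ ∧ (∃ k : Fin n, m ≤ k.val ∧ τ ⟨m - 1, by omega⟩ < τ k) ∧
    ∃ j : Fin n, j.val < m ∧ τ j < τ ⟨m, hm⟩

/-! ### Falling chains over `s_i w₀` and admissible permutations. -/

section

variable {i : ℕ} (hi : 1 ≤ i) (hin : i < n)

theorem lowerPerm_apply (j : Fin n) :
    (((simpleTransposition n i hi hin * longestPerm n) j : Fin n) : ℕ) =
      if n - 1 - j.val = i - 1 then i else if n - 1 - j.val = i then i - 1 else n - 1 - j.val := by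
  simp only [simpleTransposition, longestPerm, Equiv.Perm.mul_apply, Fin.revPerm_apply,
    Equiv.swap_apply_def, Fin.ext_iff, Fin.val_rev]
  have := j.2
  split_ifs <;> simp only [Fin.val_rev] <;> omega

theorem lowerPerm_symm_apply (a : Fin n) :
    (((simpleTransposition n i hi hin * longestPerm n).symm a : Fin n) : ℕ) =
      n - 1 - if a.val = i - 1 then i else if a.val = i then i - 1 else a.val := by
  have h : (simpleTransposition n i hi hin * longestPerm n).symm a =
      Fin.rev (simpleTransposition n i hi hin a) := by
    rw [Equiv.symm_apply_eq]
    simp [simpleTransposition, longestPerm]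
  rw [h]
  simp only [simpleTransposition, Equiv.swap_apply_def, Fin.ext_iff, Fin.val_rev]
  have := a.2
  split_ifs <;> (try simp only) <;> omega

/-- The transposition exchanges the entries of `w₀` at positions `n - i - 1` and `n - i`, which only
the prefix of length `n - i` separates. -/
theorem prefixSet_lowerPerm {j : ℕ} (hj : j ≠ n - i) (hjn : j ≤ n) :
    prefixSet (simpleTransposition n i hi hin * longestPerm n) j = lowestPath n j := by
  ext a
  rw [mem_prefixSet, lowerPerm_symm_apply, mem_lowestPath]
  have := a.2
  split_ifs <;> omega

theorem prefixSet_lowerPerm_self :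
    prefixSet (simpleTransposition n i hi hin * longestPerm n) (n - i) =
      insert ⟨i - 1, by omega⟩ ((lowestPath n (n - i)).erase ⟨i, hin⟩) := by
  ext a
  rw [mem_prefixSet, lowerPerm_symm_apply, Finset.mem_insert, Finset.mem_erase, mem_lowestPath]
  have := a.2
  simp only [Fin.ext_iff, ne_eq]
  split_ifs <;> omega

/-- The descent is the falling condition at the only ascent of `σ`. If one of the other two
conditions fails, some base next to rank `n - i` can be extended or shrunk only to the lowest path,
which is missing there. -/
theorem isAdmissible_of_mem {c : Fin (n + 1) → LPM n} {τ : Equiv.Perm (Fin n)}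
    (hc : IsMaximalChain c)
    (h : HasLabels c (simpleTransposition n i hi hin * longestPerm n) τ)
    (hf : IsFalling (simpleTransposition n i hi hin * longestPerm n) τ) :
    IsAdmissible (n - i) τ (by omega) := by
  set σ := simpleTransposition n i hi hin * longestPerm n with hσ
  obtain ⟨m, hm⟩ : ∃ m, m = n - i := ⟨_, rfl⟩
  have hm1 : 1 ≤ m := by omega
  have hmn : m < n := by omega
  have key : IsAdmissible m τ hmn := by
    have hpre := eq_prefixSet hc h
    have hle : ∀ (j : ℕ) (hj : j < n), c ⟨j, by omega⟩ ≤ c ⟨j + 1, by omega⟩ :=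
      fun j hj => (hc.2.2 ⟨j, hj⟩).1.1
    have h1 := hle (m - 1) (by omega)
    have h2 := hle m hmn
    simp only [show m - 1 + 1 = m by omega] at h1
    obtain ⟨hLx, hUx⟩ := hpre ⟨m - 1, by omega⟩
    obtain ⟨hLy, hUy⟩ := hpre ⟨m, by omega⟩
    obtain ⟨hLz, hUz⟩ := hpre ⟨m + 1, by omega⟩
    simp only at hLx hUx hLy hUy hLz hUz
    have hx : (prefixSet τ (m - 1)) = (prefixSet τ m).erase (τ ⟨m - 1, by omega⟩) := by
      have := prefixSet_eq_erase τ ⟨m - 1, by omega⟩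
      simpa only [show m - 1 + 1 = m by omega] using this
    have hz := prefixSet_succ τ ⟨m, hmn⟩
    simp only at hz
    have hcard := card_prefixSet τ hmn.le
    have hmem : τ ⟨m - 1, by omega⟩ ∈ prefixSet τ m := by simp; omega
    have hnotMem : τ ⟨m, hmn⟩ ∉ prefixSet τ m := by simp
    have hσm : prefixSet σ m = insert ⟨i - 1, by omega⟩ ((lowestPath n m).erase ⟨i, hin⟩) := by
      rw [hm]
      exact prefixSet_lowerPerm_self hi hin
    rw [hσm] at hLy
    rw [hσ, prefixSet_lowerPerm hi hin (by omega) (by omega)] at hLx hLz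
    have hDP : WeaklyBelow (lowestPath n m) (prefixSet τ m) :=
      (weaklyBelow_lowestPath_iff hmn.le).2 hcard.ge
    have hbase : ∀ C : Finset (Fin n), WeaklyBelow (c ⟨m, by omega⟩).L C →
        WeaklyBelow C (c ⟨m, by omega⟩).U → C.card = m ∧ C ≠ lowestPath n m := by
      intro C hC hC'
      have e1 := hC.card_le
      have e2 := hC'.card_le
      have e3 := (c ⟨m, by omega⟩).card_eq
      rw [e3] at e1
      rw [hUy, hcard] at e1 e2
      have e4 : C.card = m := by omega
      rw [hLy] at hC
      refine ⟨e4, ?_⟩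
      subst hm
      exact (weaklyBelow_insert_erase_lowestPath_iff hi hin e4).1 hC
    refine ⟨?_, ?_, ?_⟩
    · have h3 := hf ⟨m - 1, by omega⟩ ⟨m, hmn⟩ (by simp; omega)
      by_contra hcon
      refine h3 (Prod.mk_lt_mk.2 (Or.inl ⟨?_, not_lt.1 hcon⟩))
      rw [Fin.lt_def, hσ, lowerPerm_apply, lowerPerm_apply]
      simp only
      split_ifs <;> omega
    -- Otherwise the upper path of rank `m` contains every position from `a` on. Then the lowest
    -- path without `a` is a base one rank below, and any extension other than the lowest path is
    -- too high at time `a`.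
    · by_contra! hcon
      have hlt : ∀ q ∈ (prefixSet τ m)ᶜ, q < τ ⟨m - 1, by omega⟩ := by
        intro q hq
        rw [Finset.mem_compl, mem_prefixSet, not_lt] at hq
        have h3 := hcon _ hq
        rw [Equiv.apply_symm_apply] at h3
        refine lt_of_le_of_ne h3 fun e => ?_
        rw [e, Equiv.symm_apply_apply] at hq
        simp at hq; omega
      set a := τ ⟨m - 1, by omega⟩ with ha
      have hcomp := northCount_compl (prefixSet τ m) (t := a.val) a.2.le
      rw [northCount_eq_card_of_forall_lt (A := (prefixSet τ m)ᶜ) hlt, Finset.card_compl,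
        Fintype.card_fin, hcard] at hcomp
      have haD : a ∈ lowestPath n m := by rw [mem_lowestPath]; omega
      have hDc := card_lowestPath (n := n) (k := m) hmn.le
      have hDe := Finset.card_erase_add_one haD
      obtain ⟨C, hBC, hC1, hC2⟩ := exists_isBase_superset_of_le h1
        (B := (lowestPath n m).erase a)
        (by rw [hLx, weaklyBelow_lowestPath_iff (by omega)]; omega)
        (by
          rw [hUx, hx]
          intro t
          have e1 := northCount_erase haD t
          have e2 := northCount_erase hmem t
          have e3 := hDP t
          omega)
      obtain ⟨hCm, hCD⟩ := hbase C hC1 hC2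
      rw [hUy] at hC2
      obtain ⟨y, hyC, hyD⟩ : ∃ y ∈ C, y ∉ lowestPath n m := by
        by_contra! hcon
        exact hCD (Finset.eq_of_subset_of_card_le hcon (by omega))
      rw [mem_lowestPath] at hyD
      have e1 := northCount_mono (A := insert y ((lowestPath n m).erase a)) (B := C)
        (Finset.insert_subset hyC hBC) a.val
      rw [northCount_insert (by simp [mem_lowestPath]; omega), if_pos (by omega)] at e1
      have e2 := northCount_erase haD a.val
      have e3 := hC2 a.val
      rw [northCount_lowestPath a.2.le] at e2
      simp only [lt_irrefl, if_false] at e2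
      omega
    -- Otherwise the upper path of rank `m` is still at height `0` after position `b`. The lowest
    -- path together with `b` is a base one rank above; a base of rank `m` inside it would have to
    -- use `b`, which is too early.
    · by_contra! hcon
      have hlt : ∀ q ∈ prefixSet τ m, τ ⟨m, hmn⟩ < q := by
        intro q hq
        have h3 := hcon (τ.symm q) (by simpa using hq)
        rw [Equiv.apply_symm_apply] at h3
        exact lt_of_le_of_ne h3 fun e => hnotMem (e ▸ hq)
      set b := τ ⟨m, hmn⟩ with hb
      have hP0 : northCount (prefixSet τ m) (b.val + 1) = 0 :=
        northCount_eq_zero_of_forall_le fun a ha => hlt a ha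
      have hbound := card_le_northCount_add (prefixSet τ m) (t := b.val + 1) b.2
      have hbD : b ∉ lowestPath n m := by
        have := b.2
        rw [mem_lowestPath]; omega
      have hDc := card_lowestPath (n := n) (k := m) hmn.le
      obtain ⟨B, hBC, hB1, hB2⟩ := exists_isBase_subset_of_le h2
        (C := insert b (lowestPath n m))
        (by
          rw [hLz, weaklyBelow_lowestPath_iff (by omega), Finset.card_insert_of_notMem hbD]
          omega)
        (by
          rw [hUz, hz]
          intro t
          rw [northCount_insert hbD, northCount_insert hnotMem]
          have e3 := hDP t
          omega)
      obtain ⟨hBm, hBD⟩ := hbase B hB1 hB2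
      rw [hUy] at hB2
      have hbB : b ∈ B := by
        by_contra hbB
        refine hBD (Finset.eq_of_subset_of_card_le (fun q hq => ?_) (by omega))
        rcases Finset.mem_insert.1 (hBC hq) with rfl | h'
        · exact absurd hq hbB
        · exact h'
      have e1 : 0 < northCount B (b.val + 1) := northCount_pos_iff.2 ⟨b, hbB, by omega⟩
      have e2 := hB2 (b.val + 1)
      omega
  subst hm
  exact key

theorem exists_mem_fallingChains {τ : Equiv.Perm (Fin n)}
    (hτ : IsAdmissible (n - i) τ (by omega)) :
    ∃ c : Fin (n + 1) → LPM n, IsMaximalChain c ∧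
      HasLabels c (simpleTransposition n i hi hin * longestPerm n) τ ∧
      IsFalling (simpleTransposition n i hi hin * longestPerm n) τ := by
  set σ := simpleTransposition n i hi hin * longestPerm n with hσ
  obtain ⟨hab, ⟨k, hk, hak⟩, ⟨l, hl, hlb⟩⟩ := hτ
  have hplain : ∀ j ≤ n, j ≠ n - i → ∀ B : Finset (Fin n), B.card = j →
      WeaklyBelow (prefixSet σ j) B := by
    intro j hj hjm B hB
    rw [hσ, prefixSet_lowerPerm hi hin hjm hj]
    exact (weaklyBelow_lowestPath_iff hj).2 hB.ge
  have hspecial : ∀ B : Finset (Fin n), B.card = n - i →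
      (WeaklyBelow (prefixSet σ (n - i)) B ↔ B ≠ lowestPath n (n - i)) := by
    intro B hB
    rw [hσ, prefixSet_lowerPerm_self hi hin]
    exact weaklyBelow_insert_erase_lowestPath_iff hi hin hB
  -- The lowest path is closed upwards, but this prefix contains `τ (n - i - 1)` and not the larger
  -- `τ k`.
  have hne : prefixSet τ (n - i) ≠ lowestPath n (n - i) := by
    intro e
    have h1 : τ ⟨n - i - 1, by omega⟩ ∈ prefixSet τ (n - i) := by simp; omega
    have h2 : τ k ∉ prefixSet τ (n - i) := by simpa using hk
    rw [e, mem_lowestPath] at h1 h2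
    have : (τ ⟨n - i - 1, by omega⟩).val < (τ k).val := hak
    omega
  have hcross : ∀ j ≤ n, WeaklyBelow (prefixSet σ j) (prefixSet τ j) := by
    intro j hj
    by_cases hjm : j = n - i
    · subst hjm
      exact (hspecial _ (card_prefixSet τ hj)).2 hne
    · exact hplain j hj hjm _ (card_prefixSet τ hj)
  let c : Fin (n + 1) → LPM n := fun j =>
    ⟨prefixSet τ j.val, prefixSet σ j.val,
      by rw [card_prefixSet _ (by omega), card_prefixSet _ (by omega)], hcross j.val (by omega)⟩
  have hcU : ∀ j : Fin (n + 1), (c j).U.card = j.val := fun j => card_prefixSet τ (by omega)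
  refine ⟨c, ⟨?_, ?_, fun j => ?_⟩, fun j => ?_, ?_⟩
  · ext1
    · exact prefixSet_zero τ
    · exact prefixSet_zero σ
  · ext1
    · exact prefixSet_self τ
    · exact prefixSet_self σ
  · refine covBy_of_le ?_ (by rw [hcU, hcU]; rfl)
    have hjn := j.2
    have hu : τ j ∈ (c j.succ).U := by
      change τ j ∈ prefixSet τ (j.val + 1)
      simp
    have hxU : (c j.castSucc).U = (c j.succ).U.erase (τ j) := prefixSet_eq_erase τ j
    by_cases hj1 : j.val + 1 = n - i
    · refine le_of_erase_of_ne_lowestPath hu hxU ?_ ?_ ⟨τ k, ?_, ?_⟩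
      · rw [hcU]
        change ∀ B : Finset (Fin n), B.card = j.val + 1 → (WeaklyBelow (prefixSet σ (j.val + 1)) B ↔
          B ≠ lowestPath n (j.val + 1))
        rw [hj1]
        exact hspecial
      · rw [hcU]
        exact hplain j.val (by omega) (by omega)
      · change τ k ∉ prefixSet τ (j.val + 1)
        rw [hj1]
        simpa using hk
      · have : j = ⟨n - i - 1, by omega⟩ := Fin.ext (by simp; omega)
        rw [this]
        exact hak
    · by_cases hj2 : j.val = n - i
      · refine ne_lowestPath_le_of_erase hu hxU ?_ ?_ ⟨τ l, ?_, ?_⟩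
        · rw [hcU]
          exact hplain (j.val + 1) (by omega) (by omega)
        · rw [hcU]
          change ∀ B : Finset (Fin n), B.card = j.val → (WeaklyBelow (prefixSet σ j.val) B ↔
            B ≠ lowestPath n j.val)
          rw [hj2]
          exact hspecial
        · change τ l ∈ prefixSet τ (j.val + 1)
          simp; omega
        · have : j = ⟨n - i, by omega⟩ := Fin.ext hj2
          rw [this]
          exact hlb
      · refine le_of_erase hu hxU ?_ ?_
        · rw [hcU]
          exact hplain (j.val + 1) (by omega) (by omega)
        · rw [hcU]
          exact hplain j.val (by omega) (by omega)
  · exact ⟨prefixSet_sdiff σ j, prefixSet_sdiff τ j⟩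
  -- The first coordinates increase only from position `n - i - 1` to `n - i`, and there `τ`
  -- descends.
  · intro j k' hjk hlt
    have h1 : (σ j).val ≤ (σ k').val := hlt.le.1
    have h2 : τ j ≤ τ k' := hlt.le.2
    rw [hσ, lowerPerm_apply, lowerPerm_apply] at h1
    have hk' := k'.2
    have hj : j.val = n - i - 1 := by split_ifs at h1 <;> omega
    have e1 : j = ⟨n - i - 1, by omega⟩ := Fin.ext hj
    have e2 : k' = ⟨n - i, by omega⟩ := Fin.ext (by simp; omega)
    exact absurd hab (not_lt.2 (by rw [← e1, ← e2]; exact h2))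

/-- The bijection sends a chain to its upper labels; it is injective because labels determine all
prefix sets. -/
theorem ncard_fallingChains :
    (fallingChains (simpleTransposition n i hi hin * longestPerm n)).ncard =
      {τ : Equiv.Perm (Fin n) | IsAdmissible (n - i) τ (by omega)}.ncard := by
  refine Set.ncard_congr (fun c hc => hc.2.choose) ?_ ?_ ?_
  · intro c hc
    exact isAdmissible_of_mem hi hin hc.1 hc.2.choose_spec.1 hc.2.choose_spec.2
  · intro c c' hc hc' h
    funext j
    have h1 := eq_prefixSet hc.1 hc.2.choose_spec.1 j
    have h2 := eq_prefixSet hc'.1 hc'.2.choose_spec.1 j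
    rw [← h] at h2
    ext1
    · rw [h1.2, h2.2]
    · rw [h1.1, h2.1]
  · intro τ hτ
    obtain ⟨c, h1, h2, h3⟩ := exists_mem_fallingChains hi hin hτ
    exact ⟨c, ⟨h1, τ, h2, h3⟩, labels_unique (Exists.choose_spec (⟨h1, τ, h2, h3⟩ :
      c ∈ fallingChains (simpleTransposition n i hi hin * longestPerm n)).2).1 h2⟩

end

end LPM

/-! ### Counting permutations by positions of extrema. -/

section Counting

variable {n : ℕ}

/-- If exactly one of the events `E x`, `x ∈ S`, holds for every permutation, and these events are
right translates of each other, then each of them has `n! / |S|` elements. -/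
theorem card_filter_mul_card_of_translates {ι : Type*} (S : Finset ι)
    (E : ι → Equiv.Perm (Fin n) → Prop) [∀ x, DecidablePred (E x)]
    (hex : ∀ τ, ∃ x ∈ S, E x τ) (huniq : ∀ τ, ∀ x ∈ S, ∀ y ∈ S, E x τ → E y τ → x = y)
    (htrans : ∀ x ∈ S, ∀ y ∈ S, ∃ g : Equiv.Perm (Fin n), ∀ τ, E x τ ↔ E y (τ * g))
    {x : ι} (hx : x ∈ S) :
    (Finset.univ.filter (E x)).card * S.card = n.factorial := by
  have hU : (Finset.univ : Finset (Equiv.Perm (Fin n))) =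
      S.biUnion (fun y => Finset.univ.filter (E y)) := by
    ext τ
    simpa using hex τ
  have hcard : ∀ y ∈ S, (Finset.univ.filter (E y)).card = (Finset.univ.filter (E x)).card := by
    intro y hy
    obtain ⟨g, hg⟩ := htrans y hy x hx
    refine Finset.card_equiv (Equiv.mulRight g) fun τ => ?_
    simp [hg]
  have h := congrArg Finset.card hU
  rw [Finset.card_biUnion, Finset.sum_congr rfl hcard, Finset.sum_const, Finset.card_univ,
    Fintype.card_perm, Fintype.card_fin, smul_eq_mul] at h
  · rw [h, mul_comm]
  · intro y hy z hz hyz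
    rw [Function.onFun, Finset.disjoint_left]
    intro τ h1 h2
    simp only [Finset.mem_filter, Finset.mem_univ, true_and] at h1 h2
    exact hyz (huniq τ y hy z hz h1 h2)

theorem swap_apply_mem_iff {S : Finset (Fin n)} {p q : Fin n} (hp : p ∈ S) (hq : q ∈ S)
    (j : Fin n) : Equiv.swap p q j ∈ S ↔ j ∈ S := by
  rw [Equiv.swap_apply_def]
  split_ifs with h1 h2
  · simp [h1, hp, hq]
  · simp [h2, hp, hq]
  · rfl

theorem forall_swap_apply_iff {S : Finset (Fin n)} {p q : Fin n} (hp : p ∈ S) (hq : q ∈ S)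
    (P : Fin n → Prop) : (∀ j ∈ S, P (Equiv.swap p q j)) ↔ ∀ j ∈ S, P j := by
  constructor
  · intro h j hj
    have := h (Equiv.swap p q j) ((swap_apply_mem_iff hp hq j).2 hj)
    rwa [Equiv.swap_apply_self] at this
  · exact fun h j hj => h _ ((swap_apply_mem_iff hp hq j).2 hj)

/-- Swapping positions within `S` shows that each of them carries the maximum equally often. -/
theorem card_filter_isMax {S : Finset (Fin n)} {p : Fin n} (hp : p ∈ S) :
    (Finset.univ.filter (fun τ : Equiv.Perm (Fin n) => ∀ j ∈ S, τ j ≤ τ p)).card * S.card =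
      n.factorial := by
  refine card_filter_mul_card_of_translates S
    (fun p (τ : Equiv.Perm (Fin n)) => ∀ j ∈ S, τ j ≤ τ p) ?_ ?_ ?_ hp
  · exact fun τ => S.exists_max_image τ ⟨p, hp⟩
  · exact fun τ x hx y hy h1 h2 => τ.injective (le_antisymm (h2 x hx) (h1 y hy))
  · intro x hx y hy
    refine ⟨Equiv.swap x y, fun τ => ?_⟩
    simp only [Equiv.Perm.mul_apply, Equiv.swap_apply_right]
    exact (forall_swap_apply_iff hx hy (fun j => τ j ≤ τ x)).symm

theorem card_filter_isMin {S : Finset (Fin n)} {p : Fin n} (hp : p ∈ S) :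
    (Finset.univ.filter (fun τ : Equiv.Perm (Fin n) => ∀ j ∈ S, τ p ≤ τ j)).card * S.card =
      n.factorial := by
  refine card_filter_mul_card_of_translates S
    (fun p (τ : Equiv.Perm (Fin n)) => ∀ j ∈ S, τ p ≤ τ j) ?_ ?_ ?_ hp
  · exact fun τ => S.exists_min_image τ ⟨p, hp⟩
  · exact fun τ x hx y hy h1 h2 => τ.injective (le_antisymm (h1 y hy) (h2 x hx))
  · intro x hx y hy
    refine ⟨Equiv.swap x y, fun τ => ?_⟩
    simp only [Equiv.Perm.mul_apply, Equiv.swap_apply_right]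
    exact (forall_swap_apply_iff hx hy (fun j => τ x ≤ τ j)).symm

/-- Disjointness lets a swap inside `S` and a swap inside `T` act independently, so all pairs of
positions are equally frequent. -/
theorem card_filter_isMin_isMax {S T : Finset (Fin n)} (hST : Disjoint S T) {p r : Fin n}
    (hp : p ∈ S) (hr : r ∈ T) :
    (Finset.univ.filter (fun τ : Equiv.Perm (Fin n) =>
      (∀ j ∈ S, τ p ≤ τ j) ∧ ∀ k ∈ T, τ k ≤ τ r)).card * (S.card * T.card) = n.factorial := by
  rw [← Finset.card_product]
  refine card_filter_mul_card_of_translates (S ×ˢ T)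
    (fun x (τ : Equiv.Perm (Fin n)) => (∀ j ∈ S, τ x.1 ≤ τ j) ∧ ∀ k ∈ T, τ k ≤ τ x.2)
    ?_ ?_ ?_ (x := (p, r)) (Finset.mk_mem_product hp hr)
  · intro τ
    obtain ⟨x, hx, hx'⟩ := S.exists_min_image τ ⟨p, hp⟩
    obtain ⟨y, hy, hy'⟩ := T.exists_max_image τ ⟨r, hr⟩
    exact ⟨(x, y), Finset.mk_mem_product hx hy, hx', hy'⟩
  · rintro τ ⟨x, y⟩ hxy ⟨x', y'⟩ hxy' ⟨h1, h2⟩ ⟨h3, h4⟩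
    rw [Finset.mem_product] at hxy hxy'
    exact Prod.ext (τ.injective (le_antisymm (h1 _ hxy'.1) (h3 _ hxy.1)))
      (τ.injective (le_antisymm (h4 _ hxy.2) (h2 _ hxy'.2)))
  · rintro ⟨x, y⟩ hxy ⟨x', y'⟩ hxy'
    rw [Finset.mem_product] at hxy hxy'
    refine ⟨Equiv.swap x x' * Equiv.swap y y', fun τ => ?_⟩
    have hne : ∀ s ∈ S, ∀ t ∈ T, s ≠ t := fun s hs t ht e =>
      Finset.disjoint_left.1 hST hs (e ▸ ht)
    have hS : ∀ j ∈ S, (τ * (Equiv.swap x x' * Equiv.swap y y')) j = τ (Equiv.swap x x' j) := by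
      intro j hj
      simp only [Equiv.Perm.mul_apply]
      rw [Equiv.swap_apply_of_ne_of_ne (hne j hj y hxy.2) (hne j hj y' hxy'.2)]
    have hT : ∀ k ∈ T, (τ * (Equiv.swap x x' * Equiv.swap y y')) k = τ (Equiv.swap y y' k) := by
      intro k hk
      have hk' := (swap_apply_mem_iff hxy.2 hxy'.2 k).2 hk
      simp only [Equiv.Perm.mul_apply]
      rw [Equiv.swap_apply_of_ne_of_ne (hne x hxy.1 _ hk').symm (hne x' hxy'.1 _ hk').symm]
    refine and_congr ?_ ?_
    · rw [← forall_swap_apply_iff hxy.1 hxy'.1 (fun j => τ x ≤ τ j)]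
      refine forall₂_congr fun j hj => ?_
      rw [hS j hj, hS x' hxy'.1, Equiv.swap_apply_right]
    · rw [← forall_swap_apply_iff hxy.2 hxy'.2 (fun k => τ k ≤ τ y)]
      refine forall₂_congr fun k hk => ?_
      rw [hT k hk, hT y' hxy'.2, Equiv.swap_apply_right]

theorem card_filter_apply_lt (τ : Equiv.Perm (Fin n)) (a : Fin n) :
    (Finset.univ.filter (fun j => τ j < a)).card = a.val := by
  rw [← Fin.card_Iio]
  exact Finset.card_equiv τ fun j => by simp

theorem card_filter_lt_apply (τ : Equiv.Perm (Fin n)) (a : Fin n) :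
    (Finset.univ.filter (fun j => a < τ j)).card = n - 1 - a.val := by
  rw [← Fin.card_Ioi]
  exact Finset.card_equiv τ fun j => by simp

/-- The position of `j` relative to the consecutive positions `p` and `r`. -/
def positionClass (p r j : Fin n) : Fin 4 :=
  if j < p then 0 else if j = p then 1 else if j = r then 2 else 3

/-- The conditions force all values after `r` below `τ r`, which is below `τ p`, which is below all
values before `p`. Counting larger and smaller values then fixes `τ p` and `τ r`; after reversing
values, the permutation fixes `p` and `r` and preserves the two outer blocks. -/
theorem isMin_isMax_iff_positionClass {p r : Fin n} (hpr : p.val + 1 = r.val)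
    (τ : Equiv.Perm (Fin n)) :
    ((∀ j ∈ Finset.Iic p, τ p ≤ τ j) ∧ (∀ k ∈ Finset.Ici r, τ k ≤ τ r)) ∧ τ r < τ p ↔
      positionClass p r ∘ (τ.trans Fin.revPerm) = positionClass p r := by
  have hn := r.2
  constructor
  · rintro ⟨⟨h1, h2⟩, h3⟩
    simp only [Finset.mem_Iic, Finset.mem_Ici] at h1 h2
    have hp : ∀ j, τ p < τ j ↔ j < p := by
      intro j
      constructor
      · intro h
        by_contra hjp
        rcases eq_or_lt_of_le (not_lt.1 hjp) with rfl | hlt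
        · exact lt_irrefl _ h
        · have : r ≤ j := by rw [Fin.le_def]; rw [Fin.lt_def] at hlt; omega
          exact absurd (h2 j this) (not_le.2 (h3.trans h))
      · intro h
        exact lt_of_le_of_ne (h1 j h.le) fun e => h.ne (τ.injective e).symm
    have hr : ∀ j, τ j < τ r ↔ r < j := by
      intro j
      constructor
      · intro h
        by_contra hjr
        rcases eq_or_lt_of_le (not_lt.1 hjr) with rfl | hlt
        · exact lt_irrefl _ h
        · have : j ≤ p := by rw [Fin.le_def]; rw [Fin.lt_def] at hlt; omega
          exact absurd (h1 j this) (not_le.2 (h.trans h3))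
      · intro h
        exact lt_of_le_of_ne (h2 j h.le) fun e => h.ne (τ.injective e).symm
    have hpv := card_filter_lt_apply τ (τ p)
    have hrv := card_filter_apply_lt τ (τ r)
    simp only [hp, hr, Finset.filter_gt_eq_Iio, Finset.filter_lt_eq_Ioi, Fin.card_Iio,
      Fin.card_Ioi] at hpv hrv
    have := (τ p).2
    have hrp : Fin.rev (τ p) = p := by ext; rw [Fin.val_rev]; omega
    have hrr : Fin.rev (τ r) = r := by ext; rw [Fin.val_rev]; omega
    have hj1 : ∀ j, Fin.rev (τ j) < p ↔ j < p := by
      intro j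
      rw [← hp j]
      nth_rw 1 [← hrp]
      rw [Fin.rev_lt_rev]
    have hj2 : ∀ j, Fin.rev (τ j) = p ↔ j = p := by
      intro j
      nth_rw 1 [← hrp]
      rw [Fin.rev_inj, τ.injective.eq_iff]
    have hj3 : ∀ j, Fin.rev (τ j) = r ↔ j = r := by
      intro j
      nth_rw 1 [← hrr]
      rw [Fin.rev_inj, τ.injective.eq_iff]
    funext j
    simp only [positionClass, Function.comp, Equiv.trans_apply, Fin.revPerm_apply, hj1, hj2, hj3]
  · intro h
    have hclass : ∀ j, ((Fin.rev (τ j) < p ↔ j < p) ∧ (Fin.rev (τ j) = p ↔ j = p)) ∧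
        (Fin.rev (τ j) = r ↔ j = r) := by
      intro j
      have hj := congrFun h j
      simp only [positionClass, Function.comp, Equiv.trans_apply, Fin.revPerm_apply] at hj
      simp only [Fin.lt_def, Fin.ext_iff] at hj ⊢
      split_ifs at hj <;> first | (exfalso; revert hj; decide) | omega
    have hrp : Fin.rev (τ p) = p := (hclass p).1.2.2 rfl
    have hrr : Fin.rev (τ r) = r := (hclass r).2.2 rfl
    refine ⟨⟨fun j hj => ?_, fun k hk => ?_⟩, ?_⟩
    · rw [Finset.mem_Iic] at hj
      rw [← Fin.rev_le_rev, hrp]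
      rcases eq_or_lt_of_le hj with rfl | hlt
      · exact hrp.le
      · exact ((hclass j).1.1.2 hlt).le
    · rw [Finset.mem_Ici] at hk
      rw [← Fin.rev_le_rev, hrr, Fin.le_def]
      rw [Fin.le_def] at hk
      have := hclass k
      simp only [Fin.lt_def, Fin.ext_iff] at this
      omega
    · rw [← Fin.rev_lt_rev, hrp, hrr, Fin.lt_def]
      omega

/-- The permutations preserving a colouring number the product of the factorials of the class sizes,
here `p`, `1`, `1` and `n - 1 - r`. -/
theorem card_filter_isMin_isMax_lt {p r : Fin n} (hpr : p.val + 1 = r.val) :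
    (Finset.univ.filter (fun τ : Equiv.Perm (Fin n) =>
      ((∀ j ∈ Finset.Iic p, τ p ≤ τ j) ∧ ∀ k ∈ Finset.Ici r, τ k ≤ τ r) ∧ τ r < τ p)).card =
      p.val.factorial * (n - 1 - r.val).factorial := by
  have h1 : (Finset.univ.filter (fun τ : Equiv.Perm (Fin n) =>
      ((∀ j ∈ Finset.Iic p, τ p ≤ τ j) ∧ ∀ k ∈ Finset.Ici r, τ k ≤ τ r) ∧ τ r < τ p)).card =
      Fintype.card {g : Equiv.Perm (Fin n) // positionClass p r ∘ g = positionClass p r} := by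
    rw [Fintype.card_subtype]
    refine Finset.card_equiv (Equiv.mulLeft Fin.revPerm) fun τ => ?_
    rw [Finset.mem_filter, Finset.mem_filter, isMin_isMax_iff_positionClass hpr]
    simp only [Finset.mem_univ, true_and]
    rfl
  have e0 : Finset.univ.filter (fun a => positionClass p r a = 0) = Finset.Iio p := by
    ext a
    rw [Finset.mem_filter]
    simp only [positionClass, Finset.mem_univ, true_and, Finset.mem_Iio]
    split_ifs <;> simp_all
  have e1 : Finset.univ.filter (fun a => positionClass p r a = 1) = {p} := by
    ext a
    rw [Finset.mem_filter]
    simp only [positionClass, Finset.mem_univ, true_and, Finset.mem_singleton]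
    simp only [Fin.lt_def, Fin.ext_iff]
    split_ifs <;> simp <;> omega
  have e2 : Finset.univ.filter (fun a => positionClass p r a = 2) = {r} := by
    ext a
    rw [Finset.mem_filter]
    simp only [positionClass, Finset.mem_univ, true_and, Finset.mem_singleton]
    simp only [Fin.lt_def, Fin.ext_iff]
    split_ifs <;> simp <;> omega
  have e3 : Finset.univ.filter (fun a => positionClass p r a = 3) = Finset.Ioi r := by
    ext a
    rw [Finset.mem_filter]
    simp only [positionClass, Finset.mem_univ, true_and, Finset.mem_Ioi]
    simp only [Fin.lt_def, Fin.ext_iff]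
    split_ifs <;> simp <;> omega
  rw [h1, DomMulAct.stabilizer_card, Fin.prod_univ_four]
  simp only [Fintype.card_subtype]
  rw [e0, e1, e2, e3]
  simp

end Counting

/-! ### Inclusion-exclusion for admissible permutations. -/

namespace LPM

variable {n : ℕ}

open Classical in
-- `X` counts the descents at `m - 1`, `A` and `B` the failures of the second and third conditions,
-- and `D` both failures together. The equations are additive to avoid subtraction in `ℕ`.
theorem ncard_isAdmissible {m : ℕ} (hm : 1 ≤ m) (hmn : m < n) :
    ∃ X A B D : ℕ, {τ : Equiv.Perm (Fin n) | IsAdmissible m τ hmn}.ncard + A + B = X + D ∧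
      X * 2 = n.factorial ∧ A * (n - m + 1) = n.factorial ∧ B * (m + 1) = n.factorial ∧
      (D + (m - 1).factorial * (n - 1 - m).factorial) * (m * (n - m)) = n.factorial := by
  set p : Fin n := ⟨m - 1, by omega⟩ with hp
  set r : Fin n := ⟨m, hmn⟩ with hr
  have hpr : p.val + 1 = r.val := by simp [hp, hr]; omega
  have hrv : r.val = m := rfl
  have hprne : p ≠ r := fun e => by rw [e] at hpr; omega
  let X := Finset.univ.filter (fun τ : Equiv.Perm (Fin n) =>
    ∀ j ∈ ({p, r} : Finset (Fin n)), τ j ≤ τ p)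
  let A := Finset.univ.filter (fun τ : Equiv.Perm (Fin n) => ∀ j ∈ Finset.Ici p, τ j ≤ τ p)
  let B := Finset.univ.filter (fun τ : Equiv.Perm (Fin n) => ∀ j ∈ Finset.Iic r, τ r ≤ τ j)
  let G := Finset.univ.filter (fun τ : Equiv.Perm (Fin n) => IsAdmissible m τ hmn)
  have hXle : ∀ τ : Equiv.Perm (Fin n), τ ∈ X ↔ τ r ≤ τ p := fun τ => by simp [X]
  have hAX : A ⊆ X := by
    intro τ hτ
    rw [hXle]
    exact (Finset.mem_filter.1 hτ).2 r (by rw [Finset.mem_Ici, Fin.le_def]; omega)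
  have hBX : B ⊆ X := by
    intro τ hτ
    rw [hXle]
    exact (Finset.mem_filter.1 hτ).2 p (by rw [Finset.mem_Iic, Fin.le_def]; omega)
  have hG : G = X \ (A ∪ B) := by
    ext τ
    rw [Finset.mem_sdiff, hXle, Finset.mem_union, not_or]
    simp only [G, A, B, Finset.mem_filter, Finset.mem_univ, true_and, Finset.mem_Ici, Finset.mem_Iic]
    unfold IsAdmissible
    push Not
    refine and_congr ⟨le_of_lt, fun h => lt_of_le_of_ne h
      (fun e => hprne (τ.injective e).symm)⟩ (and_congr ?_ ?_)
    · refine exists_congr fun k => and_congr_left fun h => ?_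
      have : k.val ≠ p.val := fun e => h.ne (by rw [Fin.ext e])
      rw [Fin.le_def]
      omega
    · refine exists_congr fun k => and_congr_left fun h => ?_
      have : k.val ≠ r.val := fun e => h.ne (by rw [Fin.ext e])
      rw [Fin.le_def]
      omega
  have hGcard : {τ : Equiv.Perm (Fin n) | IsAdmissible m τ hmn}.ncard = G.card := by
    rw [← Set.ncard_coe_finset]
    congr 1
    ext τ
    simp [G]
  have hD : (A ∩ B).card + (m - 1).factorial * (n - 1 - m).factorial =
      (Finset.univ.filter (fun τ : Equiv.Perm (Fin n) =>
        (∀ j ∈ Finset.Iic p, τ p ≤ τ j) ∧ ∀ k ∈ Finset.Ici r, τ k ≤ τ r)).card := by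
    conv_rhs =>
      rw [← Finset.card_filter_add_card_filter_not (fun τ : Equiv.Perm (Fin n) => τ p < τ r),
        Finset.filter_filter, Finset.filter_filter]
    congr 1
    -- Exchanging the entries at `p` and `r` turns overlapping ranges into disjoint ones: the
    -- minimum over `Iic r` moves to `p` and the maximum over `Ici p` to `r`, at the price of
    -- requiring `τ p < τ r`.
    · refine Finset.card_equiv (Equiv.mulRight (Equiv.swap p r)) fun τ => ?_
      simp only [A, B, Finset.mem_inter, Finset.mem_filter, Finset.mem_univ, true_and,
        Equiv.coe_mulRight, Equiv.Perm.mul_apply, Equiv.swap_apply_left, Equiv.swap_apply_right,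
        Finset.mem_Ici, Finset.mem_Iic]
      have hs : ∀ k, k ≠ p → k ≠ r → Equiv.swap p r k = k :=
        fun k h1 h2 => Equiv.swap_apply_of_ne_of_ne h1 h2
      have hple : p ≤ r := by rw [Fin.le_def]; omega
      have hplt : p < r := by rw [Fin.lt_def]; omega
      have hstep : ∀ k, p < k → r ≤ k := fun k h => by
        rw [Fin.lt_def] at h; rw [Fin.le_def]; omega
      have hstep' : ∀ k, k < r → k ≤ p := fun k h => by
        rw [Fin.lt_def] at h; rw [Fin.le_def]; omega
      constructor
      · rintro ⟨h1, h2⟩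
        refine ⟨⟨fun j hj => ?_, fun k hk => ?_⟩, lt_of_le_of_ne (h1 r hple)
          fun e => hprne (τ.injective e).symm⟩
        · rcases eq_or_lt_of_le hj with rfl | hlt
          · rw [Equiv.swap_apply_left]
          · rw [hs j hlt.ne (hlt.trans hplt).ne]
            exact h2 j (hlt.trans hplt).le
        · rcases eq_or_lt_of_le hk with rfl | hlt
          · rw [Equiv.swap_apply_right]
          · rw [hs k (hplt.trans hlt).ne' hlt.ne']
            exact h1 k (hplt.trans hlt).le
      · rintro ⟨⟨h1, h2⟩, h3⟩
        refine ⟨fun k hk => ?_, fun j hj => ?_⟩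
        · rcases eq_or_lt_of_le hk with rfl | hlt
          · exact le_rfl
          · rcases eq_or_lt_of_le (hstep k hlt) with rfl | hlt'
            · exact h3.le
            · have := h2 k hlt'.le
              rwa [hs k hlt.ne' hlt'.ne'] at this
        · rcases eq_or_lt_of_le hj with rfl | hlt
          · exact le_rfl
          · rcases eq_or_lt_of_le (hstep' j hlt) with rfl | hlt'
            · exact h3.le
            · have := h1 j hlt'.le
              rwa [hs j hlt'.ne hlt.ne] at this
    · rw [show m - 1 = p.val from rfl, show n - 1 - m = n - 1 - r.val from rfl,
        ← card_filter_isMin_isMax_lt hpr]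
      congr 1
      ext τ
      simp only [Finset.mem_filter, Finset.mem_univ, true_and, not_lt]
      exact and_congr_right fun _ => ⟨le_of_lt, fun h => lt_of_le_of_ne h
        (fun e => hprne (τ.injective e).symm)⟩
  refine ⟨X.card, A.card, B.card, (A ∩ B).card, ?_, ?_, ?_, ?_, ?_⟩
  · rw [hGcard, hG, Finset.card_sdiff_of_subset (Finset.union_subset hAX hBX)]
    have h1 := Finset.card_union_add_card_inter A B
    have h2 := Finset.card_le_card (Finset.union_subset hAX hBX)
    omega
  · rw [← Finset.card_pair hprne]
    exact card_filter_isMax (by simp)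
  · have h := card_filter_isMax (S := Finset.Ici p) (p := p) (by simp)
    rw [Fin.card_Ici, show n - p.val = n - m + 1 by omega] at h
    exact h
  · have h := card_filter_isMin (S := Finset.Iic r) (p := r) (by simp)
    rwa [Fin.card_Iic] at h
  · rw [hD]
    have h := card_filter_isMin_isMax (S := Finset.Iic p) (T := Finset.Ici r) (p := p) (r := r)
      (by
        rw [Finset.disjoint_left]
        intro a h1 h2
        rw [Finset.mem_Iic, Fin.le_def] at h1
        rw [Finset.mem_Ici, Fin.le_def] at h2
        omega) (by simp) (by simp)
    rw [Fin.card_Iic, Fin.card_Ici, hpr] at h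
    exact h

end LPM

theorem theorem3p15 (n i : ℕ) (hi : 2 ≤ i) (hin : i < n) :
    ((LPM.fallingChains
        (simpleTransposition n i (Nat.le_of_succ_le hi) hin * longestPerm n)).ncard : ℚ) =
      (n.factorial : ℚ) / (((n : ℚ) - i) * ((n : ℚ) - i + 1))
        + (n.factorial : ℚ) / ((i : ℚ) * ((i : ℚ) + 1))
        + (n.factorial : ℚ) / ((i : ℚ) * ((n : ℚ) - i))
        + (n.factorial : ℚ) / 2
        - (n.factorial : ℚ) / (i : ℚ)
        - (n.factorial : ℚ) / ((n : ℚ) - i)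
        - ((i - 1).factorial : ℚ) * ((n - 1 - i).factorial : ℚ) := by
  rw [LPM.ncard_fallingChains]
  obtain ⟨X, A, B, D, h1, hX, hA, hB, hD⟩ := LPM.ncard_isAdmissible (n := n) (m := n - i)
    (by omega) (by omega)
  rw [show n - (n - i) = i by omega] at hA hD
  rw [show n - i - 1 = n - 1 - i by omega, show n - 1 - (n - i) = i - 1 by omega] at hD
  generalize Set.ncard _ = G at h1 ⊢
  have hi0 : (i : ℚ) ≠ 0 := by positivity
  have hi1 : (i : ℚ) + 1 ≠ 0 := by positivity
  have hcast : ((n - i : ℕ) : ℚ) = (n : ℚ) - i := Nat.cast_sub hin.le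
  have hm0 : (n : ℚ) - i ≠ 0 := by
    rw [← hcast]
    exact_mod_cast (by omega : n - i ≠ 0)
  have hm1 : (n : ℚ) - i + 1 ≠ 0 := by
    rw [← hcast]
    positivity
  have h1' : (G : ℚ) = X + D - A - B := by
    have : (G : ℚ) + A + B = X + D := by exact_mod_cast h1
    linarith
  have hX' : (X : ℚ) = n.factorial / 2 := by
    rw [eq_div_iff two_ne_zero]; exact_mod_cast hX
  have hA' : (A : ℚ) = n.factorial / ((i : ℚ) + 1) := by
    rw [eq_div_iff hi1]; exact_mod_cast hA
  have hB' : (B : ℚ) = n.factorial / ((n : ℚ) - i + 1) := by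
    rw [eq_div_iff hm1, ← hcast]; exact_mod_cast hB
  have hD' : (D : ℚ) = n.factorial / ((i : ℚ) * ((n : ℚ) - i)) -
      ((i - 1).factorial : ℚ) * ((n - 1 - i).factorial : ℚ) := by
    rw [eq_sub_iff_add_eq, eq_div_iff (mul_ne_zero hi0 hm0), ← hcast, ← hD]
    push_cast
    ring
  -- Partial fractions reconcile the stated form with the inclusion-exclusion terms `n!/(i + 1)` and
  -- `n!/(n - i + 1)`.
  have e1 : (n.factorial : ℚ) / ((i : ℚ) * ((i : ℚ) + 1)) =
      n.factorial / (i : ℚ) - n.factorial / ((i : ℚ) + 1) := by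
    field_simp
    ring
  have e2 : (n.factorial : ℚ) / (((n : ℚ) - i) * ((n : ℚ) - i + 1)) =
      n.factorial / ((n : ℚ) - i) - n.factorial / ((n : ℚ) - i + 1) := by
    field_simp
    ring
  rw [h1', hX', hA', hB', hD', e1, e2]
  ring
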